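/- Let $\mathbb G$ be the category generated by the graph $\sigma,\tau : 0 \rightrightarrows 1 \rightrightarrows 2 \rightrightarrows \cdots$ subject to $\sigma\sigma=\tau\sigma$ and $\sigma\tau=\tau\tau$. A globular set is a presheaf on $\mathbb G$; write $X_i$ for the set of $i$-cells of a globular set $X$ and $s,t : X_{i+1}\to X_i$ for the source and target maps. Call $a,b\in X_i$ parallel if $i=0$, or if $i\ge 1$ and $s(a)=s(b)$, $t(a)=t(b)$, and let $\mathrm{Par}_i(X)\subseteq X_i\times X_i$ be the set of parallel pairs. Let $T$ be the monad on $[\mathbb G^{\mathrm{op}},\mathbf{Set}]$ induced by the forgetful functor from strict $\omega$-categories to globular sets and its left adjoint. A globular operad is a monad $P$ on $[\mathbb G^{\mathrm{op}},\mathbf{Set}]$ which admits a cartesian monad morphism $\kappa : P\to T$, i.e. a monad morphism all of whose naturality squares are pullbacks. Let $n\ge -1$ be an integer. For $n\ge 0$, a map $f:X\to Y$ of globular sets is $n$-bijective if $f_0,\dots,f_n$ are bijections, and $n$-fully faithful if for every $i\ge n$ the square $$\begin{array}{ccc} X_{i+1} & \xrightarrow{\ f_{i+1}\ } & Y_{i+1}\\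 {\scriptstyle (s,t)}\downarrow & & \downarrow{\scriptstyle (s,t)}\\ \mathrm{Par}_i(X) & \xrightarrow{\ f_i\times f_i\ } & \mathrm{Par}_i(Y)\end{array}$$ is a pullback. Every map is $(-1)$-bijective, and the $(-1)$-fully faithful maps are the isomorphisms. **Proposition.** Let $P$ be a globular operad, let $P\text{-}\mathbf{Alg}$ be the category of $P$-algebras and $P$-algebra morphisms, and let $V : P\text{-}\mathbf{Alg}\to[\mathbb G^{\mathrm{op}},\mathbf{Set}]$ be the forgetful functor. For each integer $n\ge -1$, let $\mathcal L$ be the class of those morphisms $f$ of $P\text{-}\mathbf{Alg}$ for which $Vf$ is $n$-bijective, and $\mathcal R$ the class of those for which $Vf$ is $n$-fully faithful. Then $(\mathcal L,\mathcal R)$ is an orthogonal factorisation system on $P\text{-}\mathbf{Alg}$: every morphism factorises as a morphism in $\mathcal L$ followed by one in $\mathcal R$; and, calling $i$ orthogonal to $p$ if every commutative square from $i$ to $p$ has exactly one diagonal filler, a morphism is in $\mathcal L$ if and only if it is orthogonal to every morphism in $\mathcal R$, and a morphism is in $\mathcal R$ if and only if every morphism in $\mathcal L$ is orthogonal to it.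 -/

import Mathlib

open CategoryTheory Opposite

universe u

/-! ### Globular sets -/

/-- The objects `0, 1, 2, …` of the globe category. -/
structure Globe where
  dim : ℕ

/-- The morphisms `m ⟶ n` of the globe category: the identity if `m = n`; if `m < n`, precisely
two morphisms, `face false` (the iterated cosource `σ`) and `face true` (the iterated cotarget
`τ`); none if `n < m`. -/
inductive Globe.Hom : Globe → Globe → Type
  | id (a : Globe) : Globe.Hom a a
  | face {a b : Globe} (ε : Bool) (h : a.dim < b.dim) : Globe.Hom a b

/-- Composition in the globe category. By `σ ∘ σ = τ ∘ σ` and `σ ∘ τ = τ ∘ τ`, a composite of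
generators is determined by its length and the generator which is applied first. -/
def Globe.Hom.comp : {a b c : Globe} → Globe.Hom a b → Globe.Hom b c → Globe.Hom a c
  | _, _, _, .id _, g => g
  | _, _, _, .face ε h, .id _ => .face ε h
  | _, _, _, .face ε h, .face _ h' => .face ε (h.trans h')

/-- The globe category: generated by `σ, τ : n ⟶ n + 1`, subject to `σ ∘ σ = τ ∘ σ` and
`σ ∘ τ = τ ∘ τ` (here in normal form). -/
instance : Category Globe where
  Hom := Globe.Hom
  id := Globe.Hom.id
  comp := Globe.Hom.comp
  id_comp _ := rfl
  comp_id f := by cases f <;> rfl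
  assoc f g h := by cases f <;> cases g <;> cases h <;> rfl

/-- The morphism `m ⟶ n` for `m < n`: the iterate of `σ` if `ε = false`, of `τ` if `ε = true`. -/
def Globe.face (ε : Bool) {m n : ℕ} (h : m < n) : Globe.mk m ⟶ Globe.mk n :=
  Globe.Hom.face ε h

/-- Each `face` is an iterate of generators. -/
theorem Globe.face_succ (ε ε' : Bool) {m n : ℕ} (h : m < n) :
    Globe.face ε (h.trans n.lt_succ_self) = Globe.face ε h ≫ Globe.face ε' n.lt_succ_self := rfl

theorem Globe.face_comp_face (ε ε' : Bool) {k m n : ℕ} (h : k < m) (h' : m < n) :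
    Globe.face ε h ≫ Globe.face ε' h' = Globe.face ε (h.trans h') := rfl

/-- Globular sets: presheaves on the globe category. -/
abbrev GlobSet : Type (u + 1) := Globeᵒᵖ ⥤ Type u

namespace GlobSet

/-- The set of `n`-cells. -/
abbrev Cell (X : GlobSet.{u}) (n : ℕ) : Type u := X.obj (op (Globe.mk n))

/-- The `m`-dimensional source (`ε = false`) or target (`ε = true`) of an `n`-cell, `m < n`. -/
def bd (X : GlobSet.{u}) (ε : Bool) {m n : ℕ} (h : m < n) (x : X.Cell n) : X.Cell m :=
  X.map (Globe.face ε h).op x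

/-- The `m`-dimensional source of an `n`-cell. -/
abbrev src (X : GlobSet.{u}) {m n : ℕ} (h : m < n) (x : X.Cell n) : X.Cell m := X.bd false h x

/-- The `m`-dimensional target of an `n`-cell. -/
abbrev tgt (X : GlobSet.{u}) {m n : ℕ} (h : m < n) (x : X.Cell n) : X.Cell m := X.bd true h x

theorem bd_bd (X : GlobSet.{u}) (ε ε' : Bool) {k m n : ℕ} (h : k < m) (h' : m < n)
    (x : X.Cell n) : X.bd ε h (X.bd ε' h' x) = X.bd ε (h.trans h') x := by
  unfold bd
  rw [← Globe.face_comp_face ε ε' h h', op_comp, X.map_comp]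
  rfl

/-- The action of a map of globular sets on `n`-cells. -/
abbrev mapCell {X Y : GlobSet.{u}} (f : X ⟶ Y) (n : ℕ) (x : X.Cell n) : Y.Cell n :=
  f.app (op (Globe.mk n)) x

theorem mapCell_bd {X Y : GlobSet.{u}} (f : X ⟶ Y) (ε : Bool) {m n : ℕ} (h : m < n)
    (x : X.Cell n) : mapCell f m (X.bd ε h x) = Y.bd ε h (mapCell f n x) :=
  ConcreteCategory.congr_hom (f.naturality (Globe.face ε h).op) x

/-- Two `i`-cells are parallel if they have the same source and the same target; any two
`0`-cells are parallel. -/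
def Parallel (X : GlobSet.{u}) : (i : ℕ) → X.Cell i → X.Cell i → Prop
  | 0, _, _ => True
  | j + 1, a, b =>
      X.src (Nat.lt_succ_self j) a = X.src (Nat.lt_succ_self j) b ∧
      X.tgt (Nat.lt_succ_self j) a = X.tgt (Nat.lt_succ_self j) b

/-- The set of parallel pairs of `i`-cells. -/
def ParallelPair (X : GlobSet.{u}) (i : ℕ) : Type u :=
  {p : X.Cell i × X.Cell i // X.Parallel i p.1 p.2}

theorem Parallel.map {X Y : GlobSet.{u}} (f : X ⟶ Y) {i : ℕ} {a b : X.Cell i}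
    (h : X.Parallel i a b) : Y.Parallel i (mapCell f i a) (mapCell f i b) := by
  cases i with
  | zero => trivial
  | succ j =>
    refine ⟨?_, ?_⟩
    · rw [src, src, ← mapCell_bd, ← mapCell_bd]; exact congrArg _ h.1
    · rw [tgt, tgt, ← mapCell_bd, ← mapCell_bd]; exact congrArg _ h.2

theorem parallel_src_tgt (X : GlobSet.{u}) {i : ℕ} (x : X.Cell (i + 1)) :
    X.Parallel i (X.src (Nat.lt_succ_self i) x) (X.tgt (Nat.lt_succ_self i) x) := by
  cases i with
  | zero => trivial
  | succ j => exact ⟨by simp only [bd_bd], by simp only [bd_bd]⟩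

/-- The map `(s, t)` from `(i + 1)`-cells to parallel pairs of `i`-cells. -/
def boundary (X : GlobSet.{u}) (i : ℕ) : X.Cell (i + 1) ⟶ X.ParallelPair i :=
  TypeCat.ofHom fun x =>
    ⟨(X.src (Nat.lt_succ_self i) x, X.tgt (Nat.lt_succ_self i) x), X.parallel_src_tgt x⟩

/-- The map induced on parallel pairs of `i`-cells by a map of globular sets. -/
def mapParallelPair {X Y : GlobSet.{u}} (f : X ⟶ Y) (i : ℕ) :
    X.ParallelPair i ⟶ Y.ParallelPair i :=
  TypeCat.ofHom fun p => ⟨(mapCell f i p.1.1, mapCell f i p.1.2), p.2.map f⟩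

/-- `n`-bijective maps: `f₀, …, fₙ` are invertible (no condition for `n = -1`). -/
def nBijective (n : ℤ) : MorphismProperty GlobSet.{u} := fun _ _ f =>
  ∀ i : ℕ, (i : ℤ) ≤ n → IsIso (f.app (op (Globe.mk i)))

/-- `n`-fully faithful maps: for `n ≥ 0`, the naturality square of `(s, t)` at `f` is a pullback
for each `i ≥ n`; for `n = -1`, the isomorphisms. -/
def nFullyFaithful (n : ℤ) : MorphismProperty GlobSet.{u} := fun X Y f =>
  (n = -1 → IsIso f) ∧
  (0 ≤ n → ∀ i : ℕ, n ≤ (i : ℤ) →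
    IsPullback (f.app (op (Globe.mk (i + 1)))) (X.boundary i) (Y.boundary i)
      (mapParallelPair f i))

end GlobSet

/-! ### Strict `ω`-categories -/

/-- A strict `ω`-category: a globular set with, for all `k < n`, identities `X k → X n` (those
from `X k` to `X (k + 1)` and their iterates) and composition of `n`-cells along `k`-cells.
`comp h x y _` is the composite of first `x`, then `y`; it is defined if the `k`-target of `x`
is the `k`-source of `y`. -/
structure StrictOmegaCat : Type (u + 1) where
  cells : GlobSet.{u}
  ident : ∀ {k n : ℕ}, k < n → cells.Cell k → cells.Cell n
  comp : ∀ {k n : ℕ} (h : k < n) (x y : cells.Cell n), cells.tgt h x = cells.src h y →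
    cells.Cell n
  bd_ident : ∀ (ε : Bool) {k n : ℕ} (h : k < n) (x : cells.Cell k), cells.bd ε h (ident h x) = x
  src_comp : ∀ {k n : ℕ} (h : k < n) (x y : cells.Cell n) (w : cells.tgt h x = cells.src h y),
    cells.src h (comp h x y w) = cells.src h x
  tgt_comp : ∀ {k n : ℕ} (h : k < n) (x y : cells.Cell n) (w : cells.tgt h x = cells.src h y),
    cells.tgt h (comp h x y w) = cells.tgt h y
  bd_comp : ∀ (ε : Bool) {k m n : ℕ} (h : k < m) (h' : m < n) (x y : cells.Cell n)
    (w : cells.tgt (h.trans h') x = cells.src (h.trans h') y),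
    cells.bd ε h' (comp (h.trans h') x y w) =
      comp h (cells.bd ε h' x) (cells.bd ε h' y) (by simpa only [GlobSet.bd_bd] using w)
  ident_ident : ∀ {k m n : ℕ} (h : k < m) (h' : m < n) (x : cells.Cell k),
    ident h' (ident h x) = ident (h.trans h') x
  ident_comp : ∀ {k n : ℕ} (h : k < n) (x : cells.Cell n),
    comp h (ident h (cells.src h x)) x (bd_ident true h _) = x
  comp_ident : ∀ {k n : ℕ} (h : k < n) (x : cells.Cell n),
    comp h x (ident h (cells.tgt h x)) (bd_ident false h _).symm = x
  assoc : ∀ {k n : ℕ} (h : k < n) (x y z : cells.Cell n)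
    (w : cells.tgt h x = cells.src h y) (w' : cells.tgt h y = cells.src h z),
    comp h (comp h x y w) z ((tgt_comp h x y w).trans w') =
      comp h x (comp h y z w') (w.trans (src_comp h y z w').symm)
  /-- Interchange of composition along `k`-cells with composition along `m`-cells. (The last two
  hypotheses follow from the first four.) -/
  interchange : ∀ {k m n : ℕ} (h : k < m) (h' : m < n) (a b c d : cells.Cell n)
    (w₁ : cells.tgt h' a = cells.src h' b) (w₂ : cells.tgt h' c = cells.src h' d)
    (w₃ : cells.tgt (h.trans h') a = cells.src (h.trans h') c)
    (w₄ : cells.tgt (h.trans h') b = cells.src (h.trans h') d)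
    (w₅ : cells.tgt (h.trans h') (comp h' a b w₁) = cells.src (h.trans h') (comp h' c d w₂))
    (w₆ : cells.tgt h' (comp (h.trans h') a c w₃) = cells.src h' (comp (h.trans h') b d w₄)),
    comp (h.trans h') (comp h' a b w₁) (comp h' c d w₂) w₅ =
      comp h' (comp (h.trans h') a c w₃) (comp (h.trans h') b d w₄) w₆
  comp_ident_ident : ∀ {k m n : ℕ} (h : k < m) (h' : m < n) (x y : cells.Cell m)
    (w : cells.tgt h x = cells.src h y),
    comp (h.trans h') (ident h' x) (ident h' y)
        (by rw [GlobSet.tgt, GlobSet.src, ← cells.bd_bd true true h h',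
          ← cells.bd_bd false false h h', bd_ident, bd_ident]; exact w) =
      ident h' (comp h x y w)

namespace StrictOmegaCat

/-- Strict `ω`-functors: maps of globular sets which preserve identities and composition. -/
@[ext]
structure Hom (C D : StrictOmegaCat.{u}) where
  toMap : C.cells ⟶ D.cells
  map_ident : ∀ {k n : ℕ} (h : k < n) (x : C.cells.Cell k),
    GlobSet.mapCell toMap n (C.ident h x) = D.ident h (GlobSet.mapCell toMap k x)
  map_comp : ∀ {k n : ℕ} (h : k < n) (x y : C.cells.Cell n)
    (w : C.cells.tgt h x = C.cells.src h y),
    GlobSet.mapCell toMap n (C.comp h x y w) =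
      D.comp h (GlobSet.mapCell toMap n x) (GlobSet.mapCell toMap n y)
        (by rw [GlobSet.tgt, GlobSet.src, ← GlobSet.mapCell_bd, ← GlobSet.mapCell_bd]
            exact congrArg _ w)

theorem comp_congr (D : StrictOmegaCat.{u}) {k n : ℕ} (h : k < n) {x x' y y' : D.cells.Cell n}
    (hx : x = x') (hy : y = y') (w : D.cells.tgt h x = D.cells.src h y)
    (w' : D.cells.tgt h x' = D.cells.src h y') : D.comp h x y w = D.comp h x' y' w' := by
  subst hx hy; rfl

/-- The category of strict `ω`-categories and strict `ω`-functors. -/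
instance : Category StrictOmegaCat.{u} where
  Hom := Hom
  id C := { toMap := 𝟙 _, map_ident := fun _ _ => rfl, map_comp := fun _ _ _ _ => rfl }
  comp f g :=
    { toMap := f.toMap ≫ g.toMap
      map_ident := fun h x =>
        (congrArg (GlobSet.mapCell g.toMap _) (f.map_ident h x)).trans (g.map_ident h _)
      map_comp := fun h x y w =>
        (congrArg (GlobSet.mapCell g.toMap _) (f.map_comp h x y w)).trans (g.map_comp h _ _ _) }

/-- The forgetful functor from strict `ω`-categories to globular sets. -/
def forget : StrictOmegaCat.{u} ⥤ GlobSet.{u} where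
  obj C := C.cells
  map f := Hom.toMap f

end StrictOmegaCat

/-! ### The free strict `ω`-category on a globular set -/

/-- Formal composites of cells of `X`, without any condition of composability. -/
inductive Term (X : GlobSet.{u}) : ℕ → Type u
  | var {n : ℕ} (x : X.Cell n) : Term X n
  | ident {k n : ℕ} (h : k < n) (t : Term X k) : Term X n
  | comp {k n : ℕ} (h : k < n) (t t' : Term X n) : Term X n

namespace Term

variable {X : GlobSet.{u}}

/-- `Eval φ t a`: the term `t`, interpreted in the strict `ω`-category `D` by means of `φ`,
is defined and has the value `a`. -/
inductive Eval {D : StrictOmegaCat.{u}} (φ : X ⟶ D.cells) :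
    {n : ℕ} → Term X n → D.cells.Cell n → Prop
  | var {n : ℕ} (x : X.Cell n) : Eval φ (.var x) (GlobSet.mapCell φ n x)
  | ident {k n : ℕ} (h : k < n) {t : Term X k} {a : D.cells.Cell k} :
      Eval φ t a → Eval φ (.ident h t) (D.ident h a)
  | comp {k n : ℕ} (h : k < n) {t t' : Term X n} {a a' : D.cells.Cell n}
      (w : D.cells.tgt h a = D.cells.src h a') :
      Eval φ t a → Eval φ t' a' → Eval φ (.comp h t t') (D.comp h a a' w)

theorem Eval.unique {D : StrictOmegaCat.{u}} {φ : X ⟶ D.cells} {n : ℕ} {t : Term X n}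
    {a b : D.cells.Cell n} (ha : Eval φ t a) (hb : Eval φ t b) : a = b := by
  induction ha with
  | var x => cases hb; rfl
  | ident h _ ih => cases hb with | ident _ h' => rw [ih h']
  | comp h w _ _ ih ih' =>
    cases hb with | comp _ w' h₁ h₂ => exact D.comp_congr h (ih h₁) (ih' h₂) w w'

/-- The formal source and target of a term. -/
def bd (ε : Bool) {j : ℕ} : {n : ℕ} → j < n → Term X n → Term X j
  | _, h, .var x => .var (X.bd ε h x)
  | _, _, .ident (k := k) _ t =>
      if h₁ : j < k then t.bd ε h₁
      else if h₂ : k < j then .ident h₂ t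
      else (Nat.le_antisymm (Nat.not_lt.1 h₂) (Nat.not_lt.1 h₁) : j = k) ▸ t
  | _, h, .comp (k := k) _ t t' =>
      if h₁ : k < j then .comp h₁ (t.bd ε h) (t'.bd ε h)
      else if ε then t'.bd ε h else t.bd ε h

theorem Eval.bd {D : StrictOmegaCat.{u}} {φ : X ⟶ D.cells} (ε : Bool) {j n : ℕ} (hj : j < n)
    {t : Term X n} {a : D.cells.Cell n} (ha : Eval φ t a) :
    Eval φ (t.bd ε hj) (D.cells.bd ε hj a) := by
  induction ha with
  | var x => rw [← GlobSet.mapCell_bd]; exact .var _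
  | @ident k n h t a ha ih =>
    rw [Term.bd]
    split_ifs with h₁ h₂
    · rw [← D.cells.bd_bd ε true h₁ h, D.bd_ident]; exact ih h₁
    · rw [← D.ident_ident h₂ hj, D.bd_ident]; exact .ident h₂ ha
    · obtain rfl : j = k := by omega
      rw [D.bd_ident]; exact ha
  | @comp k n h t t' a a' w ha ha' ih ih' =>
    rw [Term.bd]
    split_ifs with h₁ h₂
    · rw [D.bd_comp ε h₁ hj]; exact .comp h₁ _ (ih hj) (ih' hj)
    · subst h₂
      have : D.cells.bd true hj (D.comp h a a' w) = D.cells.bd true hj a' := by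
        rcases Nat.lt_or_ge j k with h₃ | h₃
        · rw [← D.cells.bd_bd true true h₃ h, ← D.cells.bd_bd true true h₃ h]
          exact congrArg _ (D.tgt_comp h a a' w)
        · obtain rfl : j = k := by omega
          exact D.tgt_comp h a a' w
      rw [this]; exact ih' hj
    · obtain rfl : ε = false := by simpa using h₂
      have : D.cells.bd false hj (D.comp h a a' w) = D.cells.bd false hj a := by
        rcases Nat.lt_or_ge j k with h₃ | h₃
        · rw [← D.cells.bd_bd false false h₃ h, ← D.cells.bd_bd false false h₃ h]
          exact congrArg _ (D.src_comp h a a' w)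
        · obtain rfl : j = k := by omega
          exact D.src_comp h a a' w
      rw [this]; exact ih hj

end Term

/-- Well-formed terms: those whose interpretation in every strict `ω`-category is defined. -/
abbrev WTerm (X : GlobSet.{u}) (n : ℕ) : Type u :=
  {t : Term X n // ∀ (D : StrictOmegaCat.{u}) (φ : X ⟶ D.cells), ∃ a, t.Eval φ a}

/-- Two well-formed terms are identified if they have the same value under every interpretation
in a strict `ω`-category. -/
instance WTerm.setoid (X : GlobSet.{u}) (n : ℕ) : Setoid (WTerm X n) where
  r t t' := ∀ (D : StrictOmegaCat.{u}) (φ : X ⟶ D.cells) (a : D.cells.Cell n),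
    t.1.Eval φ a ↔ t'.1.Eval φ a
  iseqv := ⟨fun _ _ _ _ => Iff.rfl, fun h D φ a => (h D φ a).symm,
    fun h h' D φ a => (h D φ a).trans (h' D φ a)⟩

/-- The `n`-cells of the free strict `ω`-category on `X`. -/
def FreeCell (X : GlobSet.{u}) (n : ℕ) : Type u := Quotient (WTerm.setoid X n)

namespace FreeCell

variable {X : GlobSet.{u}}

/-- The value of a cell of the free strict `ω`-category in a strict `ω`-category. -/
noncomputable def ev {D : StrictOmegaCat.{u}} (φ : X ⟶ D.cells) {n : ℕ} (q : FreeCell X n) :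
    D.cells.Cell n :=
  Quotient.lift (fun t : WTerm X n => (t.2 D φ).choose)
    (fun t t' h => Term.Eval.unique ((h D φ _).1 (t.2 D φ).choose_spec) (t'.2 D φ).choose_spec) q

theorem ev_mk {D : StrictOmegaCat.{u}} (φ : X ⟶ D.cells) {n : ℕ} (t : WTerm X n)
    {a : D.cells.Cell n} (ha : t.1.Eval φ a) : ev φ (Quotient.mk _ t : FreeCell X n) = a :=
  Term.Eval.unique (t.2 D φ).choose_spec ha

theorem eval_out {D : StrictOmegaCat.{u}} (φ : X ⟶ D.cells) {n : ℕ} (q : FreeCell X n) :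
    (Quotient.out q).1.Eval φ (ev φ q) := by
  conv => rhs; rw [← Quotient.out_eq q]
  exact ((Quotient.out q).2 D φ).choose_spec

theorem ext {n : ℕ} {q q' : FreeCell X n}
    (h : ∀ (D : StrictOmegaCat.{u}) (φ : X ⟶ D.cells), ev φ q = ev φ q') : q = q' := by
  rw [← Quotient.out_eq q, ← Quotient.out_eq q']
  refine Quotient.sound fun D φ a => ⟨fun ha => ?_, fun ha => ?_⟩
  · rw [Term.Eval.unique ha (eval_out φ q), h D φ]; exact eval_out φ q'
  · rw [Term.Eval.unique ha (eval_out φ q'), ← h D φ]; exact eval_out φ q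

noncomputable def var {n : ℕ} (x : X.Cell n) : FreeCell X n :=
  Quotient.mk _ ⟨.var x, fun _ _ => ⟨_, .var x⟩⟩

noncomputable def bd (ε : Bool) {m n : ℕ} (h : m < n) (q : FreeCell X n) : FreeCell X m :=
  Quotient.mk _ ⟨(Quotient.out q).1.bd ε h, fun _ φ => ⟨_, (eval_out φ q).bd ε h⟩⟩

noncomputable def ident {k n : ℕ} (h : k < n) (q : FreeCell X k) : FreeCell X n :=
  Quotient.mk _ ⟨.ident h (Quotient.out q).1, fun _ φ => ⟨_, .ident h (eval_out φ q)⟩⟩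

theorem ev_var {D : StrictOmegaCat.{u}} (φ : X ⟶ D.cells) {n : ℕ} (x : X.Cell n) :
    ev φ (var x) = GlobSet.mapCell φ n x :=
  ev_mk φ _ (.var x)

theorem ev_bd {D : StrictOmegaCat.{u}} (φ : X ⟶ D.cells) (ε : Bool) {m n : ℕ} (h : m < n)
    (q : FreeCell X n) : ev φ (bd ε h q) = D.cells.bd ε h (ev φ q) :=
  ev_mk φ _ ((eval_out φ q).bd ε h)

theorem ev_ident {D : StrictOmegaCat.{u}} (φ : X ⟶ D.cells) {k n : ℕ} (h : k < n)
    (q : FreeCell X k) : ev φ (ident h q) = D.ident h (ev φ q) :=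
  ev_mk φ _ (.ident h (eval_out φ q))

theorem ev_composable {D : StrictOmegaCat.{u}} (φ : X ⟶ D.cells) {k n : ℕ} {h : k < n}
    {q q' : FreeCell X n} (w : bd true h q = bd false h q') :
    D.cells.tgt h (ev φ q) = D.cells.src h (ev φ q') := by
  rw [GlobSet.tgt, GlobSet.src, ← ev_bd, ← ev_bd, w]

noncomputable def comp {k n : ℕ} (h : k < n) (q q' : FreeCell X n)
    (w : bd true h q = bd false h q') : FreeCell X n :=
  Quotient.mk _ ⟨.comp h (Quotient.out q).1 (Quotient.out q').1,
    fun _ φ => ⟨_, .comp h (ev_composable φ w) (eval_out φ q) (eval_out φ q')⟩⟩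

theorem ev_comp {D : StrictOmegaCat.{u}} (φ : X ⟶ D.cells) {k n : ℕ} (h : k < n)
    (q q' : FreeCell X n) (w : bd true h q = bd false h q') :
    ev φ (comp h q q' w) = D.comp h (ev φ q) (ev φ q') (ev_composable φ w) :=
  ev_mk φ _ (.comp h (ev_composable φ w) (eval_out φ q) (eval_out φ q'))

theorem bd_bd (ε ε' : Bool) {k m n : ℕ} (h : k < m) (h' : m < n) (q : FreeCell X n) :
    bd ε h (bd ε' h' q) = bd ε (h.trans h') q :=
  ext fun D φ => by simp only [ev_bd, GlobSet.bd_bd]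

theorem bd_ident (ε : Bool) {k n : ℕ} (h : k < n) (q : FreeCell X k) :
    bd ε h (ident h q) = q :=
  ext fun D φ => by rw [ev_bd, ev_ident, D.bd_ident]

theorem src_comp {k n : ℕ} (h : k < n) (x y : FreeCell X n) (w : bd true h x = bd false h y) :
    bd false h (comp h x y w) = bd false h x :=
  ext fun D φ => by rw [ev_bd, ev_bd, ev_comp]; exact D.src_comp ..

theorem tgt_comp {k n : ℕ} (h : k < n) (x y : FreeCell X n) (w : bd true h x = bd false h y) :
    bd true h (comp h x y w) = bd true h y :=
  ext fun D φ => by rw [ev_bd, ev_bd, ev_comp]; exact D.tgt_comp ..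

theorem bd_comp (ε : Bool) {k m n : ℕ} (h : k < m) (h' : m < n) (x y : FreeCell X n)
    (w : bd true (h.trans h') x = bd false (h.trans h') y)
    (w' : bd true h (bd ε h' x) = bd false h (bd ε h' y)) :
    bd ε h' (comp (h.trans h') x y w) = comp h (bd ε h' x) (bd ε h' y) w' :=
  ext fun D φ => by
    rw [ev_bd, ev_comp, ev_comp, D.bd_comp ε h h']
    exact D.comp_congr h (ev_bd φ ε h' x).symm (ev_bd φ ε h' y).symm _ _

theorem ident_ident {k m n : ℕ} (h : k < m) (h' : m < n) (x : FreeCell X k) :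
    ident h' (ident h x) = ident (h.trans h') x :=
  ext fun D φ => by rw [ev_ident, ev_ident, ev_ident, D.ident_ident]

theorem ident_comp {k n : ℕ} (h : k < n) (x : FreeCell X n)
    (w : bd true h (ident h (bd false h x)) = bd false h x) :
    comp h (ident h (bd false h x)) x w = x :=
  ext fun D φ => by
    rw [ev_comp]
    refine (D.comp_congr h ?_ rfl _ (D.bd_ident true h _)).trans (D.ident_comp h _)
    rw [ev_ident, ev_bd]

theorem comp_ident {k n : ℕ} (h : k < n) (x : FreeCell X n)
    (w : bd true h x = bd false h (ident h (bd true h x))) :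
    comp h x (ident h (bd true h x)) w = x :=
  ext fun D φ => by
    rw [ev_comp]
    refine (D.comp_congr h rfl ?_ _ (D.bd_ident false h _).symm).trans (D.comp_ident h _)
    rw [ev_ident, ev_bd]

theorem assoc {k n : ℕ} (h : k < n) (x y z : FreeCell X n)
    (w : bd true h x = bd false h y) (w' : bd true h y = bd false h z)
    (v : bd true h (comp h x y w) = bd false h z) (v' : bd true h x = bd false h (comp h y z w')) :
    comp h (comp h x y w) z v = comp h x (comp h y z w') v' :=
  ext fun D φ => by simp only [ev_comp]; exact D.assoc ..

theorem interchange {k m n : ℕ} (h : k < m) (h' : m < n) (a b c d : FreeCell X n)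
    (w₁ : bd true h' a = bd false h' b) (w₂ : bd true h' c = bd false h' d)
    (w₃ : bd true (h.trans h') a = bd false (h.trans h') c)
    (w₄ : bd true (h.trans h') b = bd false (h.trans h') d)
    (w₅ : bd true (h.trans h') (comp h' a b w₁) = bd false (h.trans h') (comp h' c d w₂))
    (w₆ : bd true h' (comp (h.trans h') a c w₃) = bd false h' (comp (h.trans h') b d w₄)) :
    comp (h.trans h') (comp h' a b w₁) (comp h' c d w₂) w₅ =
      comp h' (comp (h.trans h') a c w₃) (comp (h.trans h') b d w₄) w₆ :=
  ext fun D φ => by simp only [ev_comp]; exact D.interchange h h' _ _ _ _ _ _ _ _ _ _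

theorem comp_ident_ident {k m n : ℕ} (h : k < m) (h' : m < n) (x y : FreeCell X m)
    (w : bd true h x = bd false h y)
    (w' : bd true (h.trans h') (ident h' x) = bd false (h.trans h') (ident h' y)) :
    comp (h.trans h') (ident h' x) (ident h' y) w' = ident h' (comp h x y w) :=
  ext fun D φ => by simp only [ev_comp, ev_ident]; exact D.comp_ident_ident ..

/-- The restriction of cells along a morphism of the globe category. -/
noncomputable def restrict : {a b : Globe} → (a ⟶ b) → FreeCell X b.dim → FreeCell X a.dim
  | _, _, .id _, q => q
  | _, _, .face ε h, q => bd ε h q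

theorem restrict_comp {a b c : Globe} (f : a ⟶ b) (g : b ⟶ c) (q : FreeCell X c.dim) :
    restrict (f ≫ g) q = restrict f (restrict g q) := by
  change Globe.Hom a b at f
  change Globe.Hom b c at g
  cases f with
  | id => rfl
  | face ε h =>
    cases g with
    | id => rfl
    | face ε' h' => exact (bd_bd ε ε' h h' q).symm

end FreeCell

/-- The underlying globular set of the free strict `ω`-category on `X`. -/
noncomputable def freeCells (X : GlobSet.{u}) : GlobSet.{u} where
  obj a := FreeCell X a.unop.dim
  map f := TypeCat.ofHom (FreeCell.restrict f.unop)
  map_id _ := rfl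
  map_comp f g := by
    ext q
    exact FreeCell.restrict_comp g.unop f.unop q

/-- The free strict `ω`-category on `X`. -/
noncomputable def freeOmegaCat (X : GlobSet.{u}) : StrictOmegaCat.{u} where
  cells := freeCells X
  ident := FreeCell.ident
  comp := FreeCell.comp
  bd_ident := FreeCell.bd_ident
  src_comp := FreeCell.src_comp
  tgt_comp := FreeCell.tgt_comp
  bd_comp ε _ _ _ h h' x y w := FreeCell.bd_comp ε h h' x y w _
  ident_ident := FreeCell.ident_ident
  ident_comp h x := FreeCell.ident_comp h x _
  comp_ident h x := FreeCell.comp_ident h x _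
  assoc h x y z w w' := FreeCell.assoc h x y z w w' _ _
  interchange := FreeCell.interchange
  comp_ident_ident h h' x y w := FreeCell.comp_ident_ident h h' x y w _

/-- The inclusion of generators. -/
noncomputable def freeUnit (X : GlobSet.{u}) : X ⟶ (freeOmegaCat X).cells where
  app a := TypeCat.ofHom fun x => (FreeCell.var x : FreeCell X a.unop.dim)
  naturality a b f := by
    obtain ⟨a⟩ := a
    obtain ⟨b⟩ := b
    obtain ⟨f, rfl⟩ : ∃ g : Globe.Hom b a, f = Quiver.Hom.op (V := Globe) g := ⟨f.unop, rfl⟩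
    ext x
    cases f with
    | id => exact congrArg FreeCell.var (ConcreteCategory.congr_hom (X.map_id _) x)
    | face ε h =>
      refine FreeCell.ext fun D φ => ?_
      refine Eq.trans ?_ (FreeCell.ev_bd φ ε h (FreeCell.var x)).symm
      rw [FreeCell.ev_var]
      exact (FreeCell.ev_var φ _).trans (GlobSet.mapCell_bd φ ε h x)

/-- The strict `ω`-functor induced by a map from `X` to a strict `ω`-category. -/
noncomputable def freeLift {X : GlobSet.{u}} {D : StrictOmegaCat.{u}} (φ : X ⟶ D.cells) :
    freeOmegaCat X ⟶ D where
  toMap :=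
    { app := fun a => TypeCat.ofHom fun q : FreeCell X a.unop.dim => FreeCell.ev φ q
      naturality := fun a b f => by
        obtain ⟨a⟩ := a
        obtain ⟨b⟩ := b
        obtain ⟨f, rfl⟩ : ∃ g : Globe.Hom b a, f = Quiver.Hom.op (V := Globe) g := ⟨f.unop, rfl⟩
        ext q
        cases f with
        | id => exact (ConcreteCategory.congr_hom (D.cells.map_id _) _).symm
        | face ε h => exact FreeCell.ev_bd φ ε h q }
  map_ident h x := FreeCell.ev_ident φ h x
  map_comp h x y w := FreeCell.ev_comp φ h x y w

theorem freeUnit_freeLift {X : GlobSet.{u}} {D : StrictOmegaCat.{u}} (φ : X ⟶ D.cells) :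
    freeUnit X ≫ (freeLift φ).toMap = φ := by
  ext a x
  exact FreeCell.ev_var φ x

theorem freeLift_unique {X : GlobSet.{u}} {D : StrictOmegaCat.{u}} (g : freeOmegaCat X ⟶ D) :
    freeLift (freeUnit X ≫ g.toMap) = g := by
  have key : ∀ {n : ℕ} (t : Term X n) (ht) (a : D.cells.Cell n),
      t.Eval (freeUnit X ≫ g.toMap) a →
      a = GlobSet.mapCell g.toMap n (Quotient.mk _ (⟨t, ht⟩ : WTerm X n) : FreeCell X n) := by
    intro n t
    induction t with
    | var x => intro ht a ha; cases ha; rfl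
    | ident h t ih =>
      intro ht a ha
      cases ha with | ident _ ha =>
      have ht' : ∀ (D : StrictOmegaCat.{u}) (φ : X ⟶ D.cells), ∃ a, t.Eval φ a := fun D φ => by
        obtain ⟨_, hb⟩ := ht D φ
        cases hb with | ident _ hb => exact ⟨_, hb⟩
      rw [ih ht' _ ha]
      refine (g.map_ident h _).symm.trans (congrArg _ (FreeCell.ext fun E ψ => ?_))
      obtain ⟨b, hb⟩ := ht' E ψ
      refine (FreeCell.ev_ident ψ h _).trans ?_
      refine (congrArg _ (FreeCell.ev_mk ψ ⟨t, ht'⟩ hb)).trans ?_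
      exact (FreeCell.ev_mk ψ _ (.ident h hb)).symm
    | @comp k n h t t' ih ih' =>
      intro ht a ha
      cases ha with | comp _ w ha ha' =>
      have hs : ∀ (D : StrictOmegaCat.{u}) (φ : X ⟶ D.cells), ∃ a b, t.Eval φ a ∧ t'.Eval φ b ∧
          D.cells.tgt h a = D.cells.src h b := fun D φ => by
        obtain ⟨_, hb⟩ := ht D φ
        cases hb with | comp _ w hb hb' => exact ⟨_, _, hb, hb', w⟩
      have h₁ : ∀ (D : StrictOmegaCat.{u}) (φ : X ⟶ D.cells), ∃ a, t.Eval φ a := fun D φ =>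
        let ⟨a, _, h, _⟩ := hs D φ; ⟨a, h⟩
      have h₂ : ∀ (D : StrictOmegaCat.{u}) (φ : X ⟶ D.cells), ∃ a, t'.Eval φ a := fun D φ =>
        let ⟨_, b, _, h, _⟩ := hs D φ; ⟨b, h⟩
      have w' : FreeCell.bd true h (Quotient.mk _ (⟨t, h₁⟩ : WTerm X n) : FreeCell X n) =
          FreeCell.bd false h (Quotient.mk _ (⟨t', h₂⟩ : WTerm X n) : FreeCell X n) := by
        refine FreeCell.ext fun E ψ => ?_
        obtain ⟨b, b', hb, hb', w'⟩ := hs E ψ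
        refine (FreeCell.ev_bd ψ true h _).trans (Eq.trans ?_ (FreeCell.ev_bd ψ false h _).symm)
        rw [FreeCell.ev_mk ψ ⟨t, h₁⟩ hb, FreeCell.ev_mk ψ ⟨t', h₂⟩ hb']
        exact w'
      refine (D.comp_congr h (ih h₁ _ ha) (ih' h₂ _ ha') w
        ((ih h₁ _ ha) ▸ (ih' h₂ _ ha') ▸ w)).trans
        ((g.map_comp h _ _ w').symm.trans (congrArg _ (FreeCell.ext fun E ψ => ?_)))
      obtain ⟨b, b', hb, hb', w''⟩ := hs E ψ
      refine (FreeCell.ev_comp ψ h _ _ w').trans ?_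
      refine (E.comp_congr h (FreeCell.ev_mk ψ ⟨t, h₁⟩ hb) (FreeCell.ev_mk ψ ⟨t', h₂⟩ hb')
        _ w'').trans ?_
      exact (FreeCell.ev_mk ψ _ (.comp h w'' hb hb')).symm
  refine StrictOmegaCat.Hom.ext ?_
  ext ⟨⟨n⟩⟩ q
  induction q using Quotient.inductionOn with
  | h t =>
    obtain ⟨a, ha⟩ := t.2 D (freeUnit X ≫ g.toMap)
    exact (FreeCell.ev_mk _ t ha).trans (key t.1 t.2 a ha)

/-- The universal property of the free strict `ω`-category. -/
noncomputable def freeEquiv (X : GlobSet.{u}) (D : StrictOmegaCat.{u}) :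
    (freeOmegaCat X ⟶ D) ≃ (X ⟶ StrictOmegaCat.forget.obj D) where
  toFun g := freeUnit X ≫ g.toMap
  invFun φ := freeLift φ
  left_inv g := freeLift_unique g
  right_inv φ := freeUnit_freeLift φ

/-- The free strict `ω`-category functor is left adjoint to the forgetful functor. -/
noncomputable def freeForgetAdjunction :
    Adjunction.leftAdjointOfEquiv (G := StrictOmegaCat.forget.{u}) freeEquiv
      (fun _ _ _ _ _ => rfl) ⊣ StrictOmegaCat.forget.{u} :=
  Adjunction.adjunctionOfEquivLeft freeEquiv (fun _ _ _ _ _ => rfl)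

/-- The monad `T` for strict `ω`-categories on the category of globular sets. -/
noncomputable def strictOmegaMonad : Monad GlobSet.{u} := freeForgetAdjunction.toMonad

/-! ### Globular operads and orthogonal factorisation systems -/

/-- A monad `P` on globular sets is a globular operad if it admits a cartesian monad morphism
`κ : P ⟶ T`, i.e. one whose naturality squares are all pullbacks. -/
def IsGlobularOperad (P : Monad GlobSet.{u}) : Prop :=
  ∃ κ : P ⟶ strictOmegaMonad.{u}, NatTrans.Equifibered κ.toNatTrans

/-- `i` is orthogonal to `p`: each commutative square from `i` to `p` has exactly one diagonal
filler. -/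
def IsOrthogonalTo {C : Type*} [Category* C] {A B X Y : C} (i : A ⟶ B) (p : X ⟶ Y) : Prop :=
  ∀ (f : A ⟶ X) (g : B ⟶ Y), f ≫ p = i ≫ g → ∃! d : B ⟶ X, i ≫ d = f ∧ d ≫ p = g

/-- `(L, R)` is an orthogonal factorisation system: each morphism factorises as one in `L`
followed by one in `R`; `L` consists of precisely the morphisms orthogonal to all those in `R`,
and `R` of precisely the morphisms to which all those in `L` are orthogonal. -/
structure IsOrthogonalFactorisationSystem {C : Type*} [Category* C]
    (L R : MorphismProperty C) : Prop where
  factorisation : ∀ {X Y : C} (f : X ⟶ Y),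
    ∃ (Z : C) (g : X ⟶ Z) (h : Z ⟶ Y), L g ∧ R h ∧ g ≫ h = f
  left_iff : ∀ {A B : C} (i : A ⟶ B),
    L i ↔ ∀ ⦃X Y : C⦄ (p : X ⟶ Y), R p → IsOrthogonalTo i p
  right_iff : ∀ {X Y : C} (p : X ⟶ Y),
    R p ↔ ∀ ⦃A B : C⦄ (i : A ⟶ B), L i → IsOrthogonalTo i p

/-! ### Coskeleta of globular sets -/

/-! Put `N = n + 1`, and let the coskeleton of `X` be the right Kan extension of its truncation to
dimensions `< N`. A map is `n`-bijective iff it is bijective in dimensions `< N`, and such a map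
induces a bijection on coskeleta. It is `n`-fully faithful iff the naturality square of the unit `X
⟶ X.cosk N` at it is a pullback (`nFullyFaithful_iff`); for `N = 0` the coskeleton is terminal,
which gives the isomorphisms. On globular sets this yields both halves. A map `f : X ⟶ Y` factorises
through the pullback of `Y ⟶ Y.cosk N ⟵ X.cosk N`, and a filler `B ⟶ X` is the same as compatible
maps from `B` to `Y` and to `X.cosk N`, the latter being forced once `A ⟶ B` is `n`-bijective.

The system lifts to algebras as soon as `P` preserves `n`-bijective maps: algebra structures, their
axioms and the compatibility of fillers all come from orthogonality of `l`, `P l` and `P (P l)` to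
the right class. Since `κ` is cartesian, `P f` is a pullback of `T f`, so it suffices to treat `T`
(`FreeCell.bijective_ev_comp_freeUnit`).

A term of dimension `< N` involves only generators of dimension `< N`. Its well-formedness and its
equality with other terms are however tested in all strict `ω`-categories `D`, and a map `X ⟶ D`
need not extend along an `n`-bijective `X ⟶ Y`. It does extend after `D` is replaced by its
coskeleton, which is again a strict `ω`-category and has the same cells in dimensions `< N`. -/

namespace Globe

/-- The iterated cosource or cotarget `m ⟶ i` if `m < i`, and the identity if `m = i`. -/
def faceLE (δ : Bool) {m i : ℕ} (h : m ≤ i) : Globe.mk m ⟶ Globe.mk i :=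
  if h' : m < i then face δ h' else eqToHom (congrArg Globe.mk (h.antisymm (not_lt.1 h')))

theorem faceLE_of_lt (δ : Bool) {m i : ℕ} (h : m < i) : faceLE δ h.le = face δ h :=
  dif_pos h

theorem faceLE_self (δ : Bool) (i : ℕ) : faceLE δ (le_refl i) = 𝟙 _ :=
  dif_neg (lt_irrefl i)

end Globe

namespace GlobSet

/-- The `m`-dimensional source or target of an `i`-cell for `m ≤ i`: the cell itself if `m = i`. -/
def bdLE (X : GlobSet.{u}) (δ : Bool) {m i : ℕ} (h : m ≤ i) (x : X.Cell i) : X.Cell m :=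
  X.map (Globe.faceLE δ h).op x

variable (X : GlobSet.{u})

theorem bdLE_of_lt (δ : Bool) {m i : ℕ} (h : m < i) (x : X.Cell i) :
    X.bdLE δ h.le x = X.bd δ h x := by
  rw [bdLE, Globe.faceLE_of_lt, bd]

@[simp]
theorem bdLE_self (δ : Bool) {i : ℕ} (x : X.Cell i) : X.bdLE δ le_rfl x = x := by
  rw [bdLE, Globe.faceLE_self, op_id, X.map_id]
  rfl

theorem bd_bdLE (ε δ : Bool) {k m i : ℕ} (h : k < m) (h' : m ≤ i) (x : X.Cell i) :
    X.bd ε h (X.bdLE δ h' x) = X.bd ε (h.trans_le h') x := by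
  rcases h'.lt_or_eq with h' | rfl
  · rw [bdLE_of_lt _ _ h', bd_bd]
  · rw [bdLE_self]

/-- By globularity the face taken last decides, unless it is trivial (`m = j`), in which case `ε`
survives. -/
theorem bdLE_bd (ε δ : Bool) {m j i : ℕ} (h : m ≤ j) (h' : j < i) (x : X.Cell i) :
    X.bdLE δ h (X.bd ε h' x) = X.bd (if m = j then ε else δ) (h.trans_lt h') x := by
  rcases h.lt_or_eq with h | rfl
  · rw [bdLE_of_lt _ _ h, bd_bd, if_neg h.ne]
  · rw [bdLE_self, if_pos rfl]

variable {X} {Y : GlobSet.{u}}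

theorem mapCell_bdLE (f : X ⟶ Y) (δ : Bool) {m i : ℕ} (h : m ≤ i) (x : X.Cell i) :
    mapCell f m (X.bdLE δ h x) = Y.bdLE δ h (mapCell f i x) :=
  ConcreteCategory.congr_hom (f.naturality (Globe.faceLE δ h).op) x

variable (X)

/-- An `i`-cell of the coskeleton of `X` with respect to the dimensions `< N`: a compatible family
of cells of `X` of dimensions `< N`, which play the role of the iterated sources
(`δ = false`) and targets (`δ = true`) of the `i`-cell, and of that cell itself if `i < N`. -/
@[ext]
structure CoskCell (N i : ℕ) : Type u where
  val : ∀ m : ℕ, m < N → m ≤ i → Bool → X.Cell m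
  -- The right-hand side does not depend on `δ`: this is globularity.
  compat : ∀ (ε δ : Bool) {k m : ℕ} (h : k < m) (hN : m < N) (hi : m ≤ i),
    X.bd ε h (val m hN hi δ) = val k (h.trans hN) (h.le.trans hi) ε
  val_top : ∀ (hN : i < N) (δ δ' : Bool), val i hN le_rfl δ = val i hN le_rfl δ'

namespace CoskCell

variable {X} {N : ℕ}

theorem val_eq {i : ℕ} (c : X.CoskCell N i) {m : ℕ} (hN : m < N) (hi : m ≤ i) (h : m = i)
    (δ δ' : Bool) : c.val m hN hi δ = c.val m hN hi δ' := by
  subst h; exact c.val_top hN δ δ'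

/-- The iterated source or target of a cell of the coskeleton. -/
@[simps]
def bd (ε : Bool) {j i : ℕ} (h : j < i) (c : X.CoskCell N i) : X.CoskCell N j where
  val m hN hj δ := c.val m hN (hj.trans h.le) (if m = j then ε else δ)
  compat ε' δ k m hk hN hj := by rw [c.compat, if_neg (hk.trans_le hj).ne]
  val_top hN δ δ' := by rw [if_pos rfl, if_pos rfl]

theorem bd_bd (ε ε' : Bool) {k m i : ℕ} (h : k < m) (h' : m < i) (c : X.CoskCell N i) :
    bd ε h (bd ε' h' c) = bd ε (h.trans h') c := by
  ext l hN hl δ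
  simp [(hl.trans_lt h).ne]

/-- The restriction of cells along a morphism of the globe category. -/
def restrict : {a b : Globe} → (a ⟶ b) → X.CoskCell N b.dim → X.CoskCell N a.dim
  | _, _, .id _, q => q
  | _, _, .face ε h, q => bd ε h q

theorem restrict_comp {a b c : Globe} (f : a ⟶ b) (g : b ⟶ c) (q : X.CoskCell N c.dim) :
    restrict (f ≫ g) q = restrict f (restrict g q) := by
  change Globe.Hom a b at f
  change Globe.Hom b c at g
  cases f with
  | id => rfl
  | face ε h =>
    cases g with
    | id => rfl
    | face ε' h' => exact (bd_bd ε ε' h h' q).symm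

/-- The cell of the coskeleton given by a cell. -/
@[simps]
def ofCell {i : ℕ} (x : X.Cell i) : X.CoskCell N i where
  val m _ hi δ := X.bdLE δ hi x
  compat ε δ k m h hN hi := by rw [bd_bdLE, bdLE_of_lt]
  val_top hN δ δ' := by rw [bdLE_self, bdLE_self]

theorem bd_ofCell (ε : Bool) {j i : ℕ} (h : j < i) (x : X.Cell i) :
    bd ε h (ofCell x : X.CoskCell N i) = ofCell (X.bd ε h x) := by
  ext m hN hj δ
  rw [bd_val, ofCell_val, ofCell_val, bdLE_bd, bdLE_of_lt X _ (hj.trans_lt h)]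

/-- The action of a map of globular sets on the cells of coskeleta. -/
@[simps]
def map (f : X ⟶ Y) {i : ℕ} (c : X.CoskCell N i) : Y.CoskCell N i where
  val m hN hi δ := mapCell f m (c.val m hN hi δ)
  compat ε δ k m h hN hi := by rw [← mapCell_bd, c.compat]
  val_top hN δ δ' := by rw [c.val_top hN δ δ']

theorem map_ofCell (f : X ⟶ Y) {i : ℕ} (x : X.Cell i) :
    map f (ofCell x : X.CoskCell N i) = ofCell (mapCell f i x) := by
  ext m hN hi δ
  exact mapCell_bdLE f δ hi x

theorem map_bd (f : X ⟶ Y) (ε : Bool) {j i : ℕ} (h : j < i) (c : X.CoskCell N i) :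
    map f (bd ε h c) = bd ε h (map f c) :=
  rfl

/-- In dimensions `< N`, a globular set agrees with its coskeleton. -/
theorem eq_ofCell {i : ℕ} (hi : i < N) (c : X.CoskCell N i) (δ : Bool) :
    c = ofCell (c.val i hi le_rfl δ) := by
  ext m hN hm ε
  rcases hm.lt_or_eq with h | rfl
  · rw [ofCell_val, bdLE_of_lt X _ h, c.compat]
  · rw [ofCell_val, bdLE_self]; exact c.val_top _ _ _

theorem ofCell_injective {i : ℕ} (hi : i < N) :
    Function.Injective (ofCell : X.Cell i → X.CoskCell N i) := fun x y h => by
  have := congrArg (fun c : X.CoskCell N i => c.val i hi le_rfl false) h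
  simpa using this

/-- A cell of dimension `≥ N` of the coskeleton is determined by its source and target. -/
theorem ext_bd {i : ℕ} (hi : N ≤ i + 1) {c c' : X.CoskCell N (i + 1)}
    (h : ∀ ε, bd ε i.lt_succ_self c = bd ε i.lt_succ_self c') : c = c' := by
  ext m hN hm δ
  -- Here `m < N ≤ i + 1`, so no component lies in dimension `i + 1`. The `δ`-component in dimension
  -- `m` can be read off the `δ`-boundary, whether `m = i` or `m < i`.
  have := congrArg (fun c : X.CoskCell N i => c.val m hN (by omega) δ) (h δ)
  simpa using this

end CoskCell

/-- The coskeleton of a globular set with respect to the dimensions `< N`. -/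
def cosk (N : ℕ) : GlobSet.{u} where
  obj a := X.CoskCell N a.unop.dim
  map f := TypeCat.ofHom (CoskCell.restrict f.unop)
  map_id _ := rfl
  map_comp f g := by
    ext q : 3
    exact CoskCell.restrict_comp g.unop f.unop q

variable {X} in
theorem cosk_ext {N i : ℕ} {c c' : (X.cosk N).Cell i}
    (h : ∀ (m : ℕ) (hN : m < N) (hm : m ≤ i) (δ : Bool),
      CoskCell.val (i := i) c m hN hm δ = CoskCell.val (i := i) c' m hN hm δ) : c = c' :=
  CoskCell.ext (by ext; apply h)

theorem val_cosk_bd {N j i : ℕ} (ε : Bool) (h : j < i) (c : (X.cosk N).Cell i) {m : ℕ} (hN : m < N)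
    (hm : m ≤ j) (δ : Bool) :
    CoskCell.val (i := j) ((X.cosk N).bd ε h c) m hN hm δ =
      CoskCell.val (i := i) c m hN (hm.trans h.le) (if m = j then ε else δ) :=
  rfl

end GlobSet

open GlobSet in
/-- A map of globular sets from its action on cells, compatible with sources and targets. -/
def GlobSet.homMk {X Y : GlobSet.{u}} (f : ∀ i, X.Cell i → Y.Cell i)
    (hf : ∀ (ε : Bool) {m i : ℕ} (h : m < i) (x : X.Cell i), f m (X.bd ε h x) = Y.bd ε h (f i x)) :
    X ⟶ Y where
  app a := TypeCat.ofHom (f a.unop.dim)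
  naturality a b g := by
    obtain ⟨a⟩ := a
    obtain ⟨b⟩ := b
    obtain ⟨g, rfl⟩ : ∃ k : Globe.Hom b a, g = Quiver.Hom.op (V := Globe) k := ⟨g.unop, rfl⟩
    ext x
    cases g with
    | id =>
      exact (congrArg (f _) (ConcreteCategory.congr_hom (X.map_id _) x)).trans
        (ConcreteCategory.congr_hom (Y.map_id _) _).symm
    | face ε h => exact hf ε h x

/-! ### The coskeleton of a strict `ω`-category -/

namespace StrictOmegaCat

open GlobSet

variable (D : StrictOmegaCat.{u}) {N : ℕ}

theorem ident_congr {k n : ℕ} (h : k < n) {x y : D.cells.Cell k} (e : x = y) :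
    D.ident h x = D.ident h y := by rw [e]

/-- Identities in the coskeleton. -/
def coskIdent {k i : ℕ} (h : k < i) (c : D.cells.CoskCell N k) : D.cells.CoskCell N i where
  val m hN hi δ :=
    -- Above dimension `k`, the faces are identities on the top component of `c`, which is available
    -- because `k < m < N`.
    if hm : m ≤ k then c.val m hN hm δ
    else D.ident (not_le.1 hm) (c.val k ((not_le.1 hm).trans hN) le_rfl δ)
  compat ε δ l m hl hN hi := by
    split_ifs with h₁ h₂ h₂
    · exact c.compat ..
    · omega
    · rcases h₂.lt_or_eq with h₃ | rfl
      · rw [← bd_bd _ ε true h₃ (not_le.1 h₁), D.bd_ident, c.compat]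
      · rw [D.bd_ident]; exact c.val_top _ _ _
    · rw [← D.ident_ident (not_le.1 h₂) hl, D.bd_ident]
      exact D.ident_congr _ (c.val_top _ _ _)
  val_top hN δ δ' := by
    rw [dif_neg h.not_ge, dif_neg h.not_ge]
    exact D.ident_congr _ (c.val_top _ _ _)

variable {D} in
-- The `k`-components of the common boundary coincide; `δ` and `δ'` are free because faces of
-- components do not depend on them.
theorem cosk_composable {k i : ℕ} {h : k < i} {x y : D.cells.CoskCell N i}
    (w : x.bd true h = y.bd false h) {m : ℕ} (hN : m < N) (hm : k < m) (hi : m ≤ i) (δ δ' : Bool) :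
    D.cells.tgt hm (x.val m hN hi δ) = D.cells.src hm (y.val m hN hi δ') := by
  have := congrArg (fun c : D.cells.CoskCell N k => c.val k (hm.trans hN) le_rfl false) w
  rw [tgt, src, x.compat, y.compat]
  simpa using this

variable {D} in
-- Below dimension `k` the components of both cells are those of their common `k`-boundary.
theorem val_eq_of_composable {k i : ℕ} {h : k < i} {x y : D.cells.CoskCell N i}
    (w : x.bd true h = y.bd false h) {m : ℕ} (hN : m < N) (hm : m < k) (hi : m ≤ i) (δ : Bool) :
    x.val m hN hi δ = y.val m hN hi δ := by
  have := congrArg (fun c : D.cells.CoskCell N k => c.val m hN hm.le δ) w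
  simpa [hm.ne] using this

/-- Composition in the coskeleton. -/
def coskComp {k i : ℕ} (h : k < i) (x y : D.cells.CoskCell N i)
    (w : x.bd true h = y.bd false h) : D.cells.CoskCell N i where
  val m hN hi δ :=
    -- In dimensions `≤ k` a composite has its sources from `x` and its targets from `y`; below `k`
    -- the two agree.
    if hm : k < m then
      D.comp hm (x.val m hN hi δ) (y.val m hN hi δ) (cosk_composable w hN hm hi δ δ)
    else bif δ then y.val m hN hi δ else x.val m hN hi δ
  compat ε δ l m hl hN hi := by
    split_ifs with h₁ h₂ h₂
    · rw [D.bd_comp ε h₂ hl]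
      exact D.comp_congr _ (x.compat ..) (y.compat ..) _ _
    · have key : ∀ (a b : D.cells.Cell m) (v : D.cells.tgt h₁ a = D.cells.src h₁ b),
          D.cells.bd ε hl (D.comp h₁ a b v) =
            bif ε then D.cells.bd ε hl b else D.cells.bd ε hl a := by
        intro a b v
        rcases (not_lt.1 h₂).lt_or_eq with h₃ | rfl
        · rw [← bd_bd _ ε ε h₃ h₁, ← bd_bd _ ε ε h₃ h₁, ← bd_bd _ ε ε h₃ h₁]
          cases ε
          · exact congrArg _ (D.src_comp ..)
          · exact congrArg _ (D.tgt_comp ..)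
        · cases ε
          · exact D.src_comp ..
          · exact D.tgt_comp ..
      rw [key, x.compat, y.compat]
    · omega
    · have e := val_eq_of_composable w (hl.trans hN) (by omega) (hl.le.trans hi) ε
      cases δ <;> cases ε <;> simp only [cond_true, cond_false, x.compat, y.compat, e]
  val_top hN δ δ' := by
    rw [dif_pos h, dif_pos h]
    exact D.comp_congr _ (x.val_top ..) (y.val_top ..) _ _

variable (N) in
/-- The coskeleton of a strict `ω`-category. -/
def cosk : StrictOmegaCat.{u} where
  cells := D.cells.cosk N
  ident := D.coskIdent
  comp := D.coskComp
  -- Every axiom is checked on components. In dimensions above those along which one composes it is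
  -- the axiom of `D`; below, operations merely select faces of their arguments.
  bd_ident ε k n h x := by
    refine cosk_ext fun m hN hm δ => ?_
    refine (dif_pos hm).trans ?_
    split_ifs with e
    · exact x.val_eq _ _ e _ _
    · rfl
  src_comp {k n} h x y w := by
    refine cosk_ext fun m hN hm δ => ?_
    refine (dif_neg hm.not_gt).trans ?_
    change _ = x.val m hN _ _
    split_ifs with e
    · rfl
    · cases δ
      · rfl
      · exact (val_eq_of_composable (h := h) w hN (hm.lt_of_ne e) _ true).symm
  tgt_comp {k n} h x y w := by
    refine cosk_ext fun m hN hm δ => ?_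
    refine (dif_neg hm.not_gt).trans ?_
    change _ = y.val m hN _ _
    split_ifs with e
    · rfl
    · cases δ
      · exact val_eq_of_composable (h := h) w hN (hm.lt_of_ne e) _ false
      · rfl
  bd_comp ε k m n h h' x y w := by
    refine cosk_ext fun l hN hl δ => ?_
    change dite _ _ _ = dite _ _ _
    split_ifs with h₁ h₂ h₂
    · exact D.comp_congr _ (congrArg _ (if_pos h₂).symm) (congrArg _ (if_pos h₂).symm) _ _
    · exact D.comp_congr _ (congrArg _ (if_neg h₂).symm) (congrArg _ (if_neg h₂).symm) _ _
    · exact absurd h₂.symm (by dsimp only; omega)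
    · rw [val_cosk_bd, val_cosk_bd, if_neg h₂]
  ident_ident {k m n} h h' x := by
    refine cosk_ext fun l hN hl δ => ?_
    change dite _ (fun _ => dite _ _ _) (fun _ => D.ident _ (dite _ _ _)) = dite _ _ _
    split_ifs with h₁ h₂ h₃ h₃ h₃
    · rfl
    · rfl
    · omega
    · omega
    · omega
    · exact D.ident_ident ..
  ident_comp {k n} h x := by
    refine cosk_ext fun m hN hm δ => ?_
    change dite _ (fun _ => D.comp _ (dite _ _ _) _ _)
      (fun _ => bif _ then _ else dite _ _ _) = _
    split_ifs with h₁ h₂ h₂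
    · omega
    · refine (D.comp_congr h₁ ?_ rfl _ (D.bd_ident true _ _)).trans (D.ident_comp h₁ _)
      refine D.ident_congr _ ?_
      rw [val_cosk_bd, if_pos rfl]
      exact (CoskCell.compat x _ _ _ _ _).symm
    · rcases h₂.lt_or_eq with h₃ | rfl
      · rw [val_cosk_bd, if_neg h₃.ne, Bool.cond_self]
      · rw [val_cosk_bd, if_pos rfl]; cases δ <;> rfl
    · omega
  comp_ident {k n} h x := by
    refine cosk_ext fun m hN hm δ => ?_
    change dite _ (fun _ => D.comp _ _ (dite _ _ _) _)
      (fun _ => bif _ then dite _ _ _ else _) = _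
    split_ifs with h₁ h₂ h₂
    · omega
    · refine (D.comp_congr h₁ rfl ?_ _ (D.bd_ident false _ _).symm).trans (D.comp_ident h₁ _)
      refine D.ident_congr _ ?_
      rw [val_cosk_bd, if_pos rfl]
      exact (CoskCell.compat x _ _ _ _ _).symm
    · rcases h₂.lt_or_eq with h₃ | rfl
      · rw [val_cosk_bd, if_neg h₃.ne, Bool.cond_self]
      · rw [val_cosk_bd, if_pos rfl]; cases δ <;> rfl
    · omega
  assoc h x y z w w' := by
    refine cosk_ext fun m hN hm δ => ?_
    change dite _ (fun _ => D.comp _ (dite _ _ _) _ _) (fun _ => bif _ then _ else dite _ _ _) =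
      dite _ (fun _ => D.comp _ _ (dite _ _ _) _) (fun _ => bif _ then dite _ _ _ else _)
    split_ifs with h₁
    · exact D.assoc ..
    · cases δ <;> rfl
  interchange {k m n} h h' a b c d w₁ w₂ w₃ w₄ w₅ w₆ := by
    refine cosk_ext fun l hN hl δ => ?_
    change dite _ (fun _ => D.comp _ (dite _ _ _) (dite _ _ _) _)
        (fun _ => bif _ then dite _ _ _ else dite _ _ _) =
      dite _ (fun _ => D.comp _ (dite _ _ _) (dite _ _ _) _)
        (fun _ => bif _ then dite _ _ _ else dite _ _ _)
    split_ifs with h₁ h₂ h₂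
    · exact D.interchange h ..
    -- For `k < l ≤ m`, composition along `m` selects a face, while composition along `k` is a
    -- composite in `D`.
    · cases δ <;> rfl
    · omega
    · cases δ <;> rfl
  comp_ident_ident {k m n} h h' x y w := by
    refine cosk_ext fun l hN hl δ => ?_
    change dite _ (fun _ => D.comp _ (dite _ _ _) (dite _ _ _) _)
        (fun _ => bif _ then dite _ _ _ else dite _ _ _) =
      dite _ (fun _ => dite _ _ _) (fun _ => D.ident _ (dite _ _ _))
    split_ifs with h₁ h₂ h₂
    · rfl
    · exact D.comp_ident_ident ..
    · cases δ <;> rfl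
    · omega

end StrictOmegaCat

/-! ### The monad for strict `ω`-categories preserves `n`-bijective maps -/

namespace GlobSet

variable {X Y Z : GlobSet.{u}} {N : ℕ}

/-- The inverse of the action on coskeleta of a map which is bijective in dimensions `< N`. -/
noncomputable def CoskCell.mapInv (f : X ⟶ Y) (hf : ∀ i < N, Function.Bijective (mapCell f i))
    {i : ℕ} (c : Y.CoskCell N i) : X.CoskCell N i where
  val m hN hi δ := (Equiv.ofBijective _ (hf m hN)).symm (c.val m hN hi δ)
  compat ε δ k m h hN hi := by
    apply (hf k (h.trans hN)).injective
    rw [mapCell_bd, Equiv.ofBijective_apply_symm_apply (mapCell f m),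
      Equiv.ofBijective_apply_symm_apply (mapCell f k), c.compat]
  val_top hN δ δ' := by rw [c.val_top hN δ δ']

theorem CoskCell.map_mapInv (f : X ⟶ Y) (hf : ∀ i < N, Function.Bijective (mapCell f i))
    {i : ℕ} (c : Y.CoskCell N i) : (c.mapInv f hf).map f = c := by
  ext m hN hi δ
  exact Equiv.ofBijective_apply_symm_apply (mapCell f m) (hf m hN) _

theorem CoskCell.mapInv_map (f : X ⟶ Y) (hf : ∀ i < N, Function.Bijective (mapCell f i))
    {i : ℕ} (c : X.CoskCell N i) : (c.map f).mapInv f hf = c := by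
  ext m hN hi δ
  exact Equiv.ofBijective_symm_apply_apply (mapCell f m) (hf m hN) _

theorem CoskCell.bd_mapInv (f : X ⟶ Y) (hf : ∀ i < N, Function.Bijective (mapCell f i))
    (ε : Bool) {j i : ℕ} (h : j < i) (c : Y.CoskCell N i) :
    (c.mapInv f hf).bd ε h = (c.bd ε h).mapInv f hf :=
  rfl

/-- The extension of a map `X ⟶ Z`, composed with the unit of the coskeleton, along a map `X ⟶ Y`
which is bijective in dimensions `< N`. -/
noncomputable def coskExtend (f : X ⟶ Y) (hf : ∀ i < N, Function.Bijective (mapCell f i))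
    (φ : X ⟶ Z) : Y ⟶ Z.cosk N :=
  homMk (fun _ y => ((CoskCell.ofCell y).mapInv f hf).map φ) fun ε m i h y => by
    rw [← CoskCell.bd_ofCell, ← CoskCell.bd_mapInv, CoskCell.map_bd]
    rfl

/-- This allows an interpretation in `D` to be replaced by one in its coskeleton that factors
through `f`. -/
theorem mapCell_comp_coskExtend (f : X ⟶ Y) (hf : ∀ i < N, Function.Bijective (mapCell f i))
    (φ : X ⟶ Z) {i : ℕ} (x : X.Cell i) :
    mapCell (f ≫ coskExtend f hf φ) i x = (CoskCell.ofCell (mapCell φ i x) : Z.CoskCell N i) := by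
  change ((CoskCell.ofCell (mapCell f i x)).mapInv f hf).map φ = _
  rw [← CoskCell.map_ofCell, CoskCell.mapInv_map, CoskCell.map_ofCell]

end GlobSet

open GlobSet

/-! ### Terms in low dimensions and the action of `T` -/

namespace Term

variable {X Y : GlobSet.{u}} {N : ℕ}

/-- The action of a map of globular sets on terms. -/
def map (f : X ⟶ Y) : {i : ℕ} → Term X i → Term Y i
  | _, .var x => .var (mapCell f _ x)
  | _, .ident h t => .ident h (t.map f)
  | _, .comp h t t' => .comp h (t.map f) (t'.map f)

theorem eval_map_iff {D : StrictOmegaCat.{u}} (f : X ⟶ Y) (φ : Y ⟶ D.cells) {i : ℕ}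
    (t : Term X i) (a : D.cells.Cell i) : (t.map f).Eval φ a ↔ t.Eval (f ≫ φ) a := by
  constructor
  · induction t with
    | var x => intro h; cases h; exact .var (φ := f ≫ φ) x
    | ident h t ih => intro h; cases h with | ident _ h => exact .ident _ (ih _ h)
    | comp h t t' ih ih' =>
      intro h; cases h with | comp _ w h h' => exact .comp _ w (ih _ h) (ih' _ h')
  · intro h
    induction h with
    | var x => exact .var (φ := φ) (mapCell f _ x)
    | ident h _ ih => exact .ident h ih
    | comp h w _ _ ih ih' => exact .comp h w ih ih'

/-- Subterms never have larger dimension than the term, so only generators of dimension `< N` occur.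
-/
theorem exists_map_eq (f : X ⟶ Y) (hf : ∀ i < N, Function.Bijective (mapCell f i)) {i : ℕ}
    (t : Term Y i) (hi : i < N) : ∃ t' : Term X i, t'.map f = t := by
  induction t with
  | var y =>
    obtain ⟨x, rfl⟩ := (hf _ hi).surjective y
    exact ⟨.var x, rfl⟩
  | ident h t ih =>
    obtain ⟨t, rfl⟩ := ih (h.trans hi)
    exact ⟨.ident h t, rfl⟩
  | comp h t t' ih ih' =>
    obtain ⟨t, rfl⟩ := ih hi
    obtain ⟨t', rfl⟩ := ih' hi
    exact ⟨.comp h t t', rfl⟩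

/-- A value of a term in a coskeleton yields one in the original strict `ω`-category. -/
theorem Eval.of_cosk {D : StrictOmegaCat.{u}} {χ : X ⟶ (D.cosk N).cells} {φ : X ⟶ D.cells}
    (hχ : ∀ (i : ℕ) (x : X.Cell i), mapCell χ i x = (CoskCell.ofCell (mapCell φ i x) :
      D.cells.CoskCell N i)) {i : ℕ} {t : Term X i} {c : (D.cosk N).cells.Cell i}
    (h : t.Eval χ c) (hi : i < N) :
    t.Eval φ (CoskCell.val (i := i) c i hi le_rfl false) := by
  induction h with
  | var x =>
    rw [hχ, CoskCell.ofCell_val, bdLE_self]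
    exact .var x
  | @ident k i h t c _ ih =>
    have : CoskCell.val (i := i) ((D.cosk N).ident h c) i hi le_rfl false =
        D.ident h (CoskCell.val (i := k) c k (h.trans hi) le_rfl false) := dif_neg h.not_ge
    rw [this]
    exact .ident h (ih _)
  | @comp k i h t t' c c' w _ _ ih ih' =>
    have : CoskCell.val (i := i) ((D.cosk N).comp h c c' w) i hi le_rfl false =
        D.comp h (CoskCell.val (i := i) c i hi le_rfl false)
          (CoskCell.val (i := i) c' i hi le_rfl false)
          (StrictOmegaCat.cosk_composable (h := h) w hi h le_rfl _ _) := dif_pos h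
    rw [this]
    exact .comp h _ (ih _) (ih' _)

end Term

namespace FreeCell

variable {X Y : GlobSet.{u}} {N : ℕ}

/-- Evaluation at `f ≫ freeUnit Y` is the action of `T f`. Both sides are strict `ω`-functors on the
free strict `ω`-category that agree on generators. -/
theorem ev_ev_comp_freeUnit {D : StrictOmegaCat.{u}} (f : X ⟶ Y) (φ : Y ⟶ D.cells) {i : ℕ}
    (q : FreeCell X i) :
    ev φ (ev (D := freeOmegaCat Y) (f ≫ freeUnit Y) q : FreeCell Y i) = ev (f ≫ φ) q := by
  have : freeLift (f ≫ freeUnit Y) ≫ freeLift φ = freeLift (f ≫ φ) := by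
    rw [← freeLift_unique (freeLift (f ≫ freeUnit Y) ≫ freeLift φ)]
    congr 1
    change freeUnit X ≫ (freeLift (f ≫ freeUnit Y)).toMap ≫ (freeLift φ).toMap = f ≫ φ
    rw [← Category.assoc, freeUnit_freeLift, Category.assoc, freeUnit_freeLift]
  exact congrArg (fun g : freeOmegaCat X ⟶ D => mapCell g.toMap i q) this

theorem ev_coskExtend {D : StrictOmegaCat.{u}} (f : X ⟶ Y)
    (hf : ∀ i < N, Function.Bijective (mapCell f i)) (φ : X ⟶ D.cells) {i : ℕ} (hi : i < N)
    (q : FreeCell X i) :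
    CoskCell.val (i := i) (ev (D := D.cosk N) (f ≫ coskExtend f hf φ) q) i hi le_rfl false =
      ev φ q :=
  Term.Eval.unique
    ((eval_out (D := D.cosk N) _ q).of_cosk (fun _ x => mapCell_comp_coskExtend f hf φ x) hi)
    (eval_out φ q)

/-- Injectivity: a test map `φ : X ⟶ D` extends along `f` into the coskeleton of `D`, and values in
dimension `i < N` can be recovered there. -/
theorem bijective_ev_comp_freeUnit (f : X ⟶ Y) (hf : ∀ i < N, Function.Bijective (mapCell f i))
    {i : ℕ} (hi : i < N) :
    Function.Bijective
      (fun q : FreeCell X i => (ev (D := freeOmegaCat Y) (f ≫ freeUnit Y) q : FreeCell Y i)) := by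
  constructor
  · intro q q' h
    refine ext fun D φ => ?_
    have := ((ev_ev_comp_freeUnit (D := D.cosk N) f (coskExtend f hf φ) q).symm.trans
      (congrArg (ev (D := D.cosk N) (coskExtend f hf φ)) h)).trans (ev_ev_comp_freeUnit f _ q')
    rw [← ev_coskExtend f hf φ hi q, ← ev_coskExtend f hf φ hi q', this]
  · intro q
    induction q using Quotient.inductionOn with
    | h t =>
    obtain ⟨t, ht⟩ := t
    obtain ⟨t, rfl⟩ := t.exists_map_eq f hf hi
    -- The lifted term must be defined under maps out of `X`, whereas `ht` concerns maps out of `Y`;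
    -- the extension into the coskeleton bridges the gap.
    have ht' : ∀ (D : StrictOmegaCat.{u}) (φ : X ⟶ D.cells), ∃ a, t.Eval φ a := fun D φ => by
      obtain ⟨c, hc⟩ := ht (D.cosk N) (coskExtend f hf φ)
      exact ⟨_, ((Term.eval_map_iff ..).1 hc).of_cosk
        (fun _ x => mapCell_comp_coskExtend f hf φ x) hi⟩
    refine ⟨Quotient.mk _ ⟨t, ht'⟩, ext fun D φ => ?_⟩
    obtain ⟨a, ha⟩ := ht D φ
    refine (ev_ev_comp_freeUnit ..).trans ?_
    exact (ev_mk (f ≫ φ) ⟨t, ht'⟩ ((Term.eval_map_iff ..).1 ha)).trans (ev_mk φ ⟨_, ht⟩ ha).symm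

end FreeCell

namespace GlobSet

variable {X Y : GlobSet.{u}}

/-- `(n + 1).toNat` is the number of dimensions `≤ n`, in particular `0` for `n = -1`. -/
theorem nBijective_iff (n : ℤ) (f : X ⟶ Y) :
    nBijective n f ↔ ∀ i < (n + 1).toNat, Function.Bijective (mapCell f i) := by
  refine forall_congr' fun i => ?_
  rw [isIso_iff_bijective]
  exact imp_congr (by omega) Iff.rfl

theorem nBijective_strictOmegaMonad_map (n : ℤ) (f : X ⟶ Y) (hf : nBijective n f) :
    nBijective n (strictOmegaMonad.{u}.map f) := by
  rw [nBijective_iff] at hf ⊢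
  exact fun i hi => FreeCell.bijective_ev_comp_freeUnit f hf hi

/-- In each dimension `P f` is a pullback of `T f` along `κ`, and isomorphisms are stable under
pullback. -/
theorem nBijective_map_of_isGlobularOperad {P : Monad GlobSet.{u}} (hP : IsGlobularOperad P) (n : ℤ)
    (f : X ⟶ Y) (hf : nBijective n f) : nBijective n (P.map f) := by
  obtain ⟨κ, hκ⟩ := hP
  intro i hi
  have := nBijective_strictOmegaMonad_map n f hf i hi
  have h := (hκ f).map ((evaluation _ _).obj (op (Globe.mk i)))
  exact MorphismProperty.of_isPullback (P := .isomorphisms _) h.flip this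

end GlobSet

/-! ### Factorisation and orthogonality for globular sets -/

namespace GlobSet

variable {X Y Z : GlobSet.{u}} {N : ℕ}

/-- All lower faces are faces of the `(i - 1)`-dimensional source and target. -/
theorem parallel_iff {i : ℕ} {a b : X.Cell i} :
    X.Parallel i a b ↔ ∀ (ε : Bool) {j : ℕ} (h : j < i), X.bd ε h a = X.bd ε h b := by
  constructor
  · intro h ε j hj
    cases i with
    | zero => exact absurd hj j.not_lt_zero
    | succ k =>
      have : ∀ ε, X.bd ε k.lt_succ_self a = X.bd ε k.lt_succ_self b := fun ε => by
        cases ε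
        · exact h.1
        · exact h.2
      rcases (Nat.lt_succ_iff.1 hj).lt_or_eq with hk | rfl
      · rw [← bd_bd X ε true hk k.lt_succ_self, this, bd_bd]
      · exact this ε
  · intro h
    cases i with
    | zero => trivial
    | succ k => exact ⟨h false _, h true _⟩

/-- A cell of the coskeleton from a parallel pair of cells of one dimension less. -/
def CoskCell.ofParallel {i : ℕ} (hi : N ≤ i + 1) (p : Bool → X.Cell i)
    (hp : X.Parallel i (p false) (p true)) : X.CoskCell N (i + 1) where
  val m hN _ δ := X.bdLE δ (Nat.lt_succ_iff.1 (hN.trans_le hi)) (p δ)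
  compat ε δ k m h hN _ := by
    have hk : k < i := h.trans_le (Nat.lt_succ_iff.1 (hN.trans_le hi))
    rw [bd_bdLE, bdLE_of_lt X ε hk]
    have := parallel_iff.1 hp ε hk
    cases ε <;> cases δ <;> simp only [this]
  val_top hN := absurd hN hi.not_gt

theorem CoskCell.bd_ofParallel {i : ℕ} (hi : N ≤ i + 1) (p : Bool → X.Cell i)
    (hp : X.Parallel i (p false) (p true)) (ε : Bool) :
    (CoskCell.ofParallel hi p hp).bd ε i.lt_succ_self = CoskCell.ofCell (p ε) := by
  ext m hN hm δ
  change X.bdLE (if m = i then ε else δ) _ (p (if m = i then ε else δ)) = X.bdLE δ hm (p ε)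
  rcases hm.lt_or_eq with h | rfl
  · rw [if_neg h.ne, bdLE_of_lt X δ h, bdLE_of_lt X δ h]
    have := parallel_iff.1 hp δ h
    cases ε <;> cases δ <;> simp only [this]
  · rw [if_pos rfl, bdLE_self, bdLE_self]

/-! ### Full faithfulness in terms of the coskeleton -/

/-- The naturality square of the unit of the coskeleton at `f` is a pullback. -/
def CoskCartesian (N : ℕ) (f : X ⟶ Y) : Prop :=
  ∀ (i : ℕ) (y : Y.Cell i) (c : X.CoskCell N i), c.map f = CoskCell.ofCell y →
    ∃! x : X.Cell i, CoskCell.ofCell x = c ∧ mapCell f i x = y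

/-- Pasting of pullback squares. -/
theorem CoskCartesian.comp {f : X ⟶ Y} {g : Y ⟶ Z} (hf : CoskCartesian N f)
    (hg : CoskCartesian N g) : CoskCartesian N (f ≫ g) := by
  intro i z c h
  obtain ⟨y, ⟨hy, rfl⟩, hy'⟩ := hg i z (c.map f) h
  obtain ⟨x, ⟨rfl, rfl⟩, hx'⟩ := hf i y c hy.symm
  exact ⟨x, ⟨rfl, rfl⟩, fun x' ⟨h₁, h₂⟩ =>
    hx' _ ⟨h₁, hy' _ ⟨by rw [← h₁, CoskCell.map_ofCell], h₂⟩⟩⟩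

theorem CoskCartesian.of_isIso (f : X ⟶ Y) [IsIso f] : CoskCartesian N f := by
  have h₁ : ∀ {i : ℕ} (x : X.Cell i), mapCell (inv f) i (mapCell f i x) = x := fun {i} x =>
    congrArg (fun g => mapCell g i x) (IsIso.hom_inv_id f)
  have h₂ : ∀ {i : ℕ} (y : Y.Cell i), mapCell f i (mapCell (inv f) i y) = y := fun {i} y =>
    congrArg (fun g => mapCell g i y) (IsIso.inv_hom_id f)
  intro i y c h
  refine ⟨mapCell (inv f) i y, ⟨?_, h₂ y⟩, ?_⟩
  · rw [← CoskCell.map_ofCell, ← h]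
    ext m hN hm δ
    exact h₁ _
  · rintro x ⟨-, rfl⟩
    exact (h₁ x).symm

/-- Indexing the pair by `Bool` lets source and target be treated together. -/
theorem isPullback_boundary_iff (f : X ⟶ Y) (i : ℕ) :
    IsPullback (f.app (op (Globe.mk (i + 1)))) (X.boundary i) (Y.boundary i)
      (mapParallelPair f i) ↔
    ∀ (y : Y.Cell (i + 1)) (p : Bool → X.Cell i), X.Parallel i (p false) (p true) →
      (∀ δ, mapCell f i (p δ) = Y.bd δ i.lt_succ_self y) →
      ∃! x, mapCell f (i + 1) x = y ∧ ∀ δ, X.bd δ i.lt_succ_self x = p δ := by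
  have hb : ∀ (x : X.Cell (i + 1)) (p : X.ParallelPair i), X.boundary i x = p ↔
      ∀ δ, X.bd δ i.lt_succ_self x = bif δ then p.1.2 else p.1.1 := fun x p => by
    rw [Bool.forall_bool]
    exact Subtype.ext_iff.trans Prod.ext_iff
  rw [Limits.Types.isPullback_iff]
  constructor
  · rintro ⟨-, hu, he⟩ y p hp h
    obtain ⟨x, hx, hx'⟩ := he y ⟨(p false, p true), hp⟩
      (Subtype.ext (Prod.ext (h false).symm (h true).symm))
    have hx'' : ∀ δ, X.bd δ i.lt_succ_self x = p δ := fun δ => by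
      rw [(hb _ _).1 hx' δ]; cases δ <;> rfl
    refine ⟨x, ⟨hx, hx''⟩, fun x' ⟨h₁, h₂⟩ => hu _ _ ⟨h₁.trans hx.symm, ?_⟩⟩
    refine ((hb _ _).2 fun δ => ?_).trans hx'.symm
    rw [h₂]; cases δ <;> rfl
  · intro h
    refine ⟨?_, fun x x' ⟨h₁, h₂⟩ => ?_, fun y p hp => ?_⟩
    · ext x
      exact Subtype.ext (Prod.ext (mapCell_bd f false _ x).symm (mapCell_bd f true _ x).symm)
    · refine (h (mapCell f _ x') (fun δ => X.bd δ i.lt_succ_self x') (X.parallel_src_tgt x')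
        fun δ => mapCell_bd ..).unique ⟨h₁, fun δ => ?_⟩ ⟨rfl, fun _ => rfl⟩
      rw [(hb _ _).1 h₂ δ]; cases δ <;> rfl
    · have e := Prod.ext_iff.1 (Subtype.ext_iff.1 hp)
      obtain ⟨x, ⟨hx, hx'⟩, -⟩ := h y (fun δ => bif δ then p.1.2 else p.1.1) p.2 fun δ => by
        cases δ
        · exact e.1.symm
        · exact e.2.symm
      exact ⟨x, hx, (hb x p).2 hx'⟩

/-- In dimensions `< N` the units are bijective, so nothing is required. In dimension `i + 1 ≥ N` a
cell of the coskeleton amounts to its boundary, which by induction lifts uniquely to a parallel pair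
in `X`. If `N` were `0`, the squares would say nothing about `0`-cells. -/
theorem coskCartesian_iff_isPullback (hN : 0 < N) (f : X ⟶ Y) :
    CoskCartesian N f ↔ ∀ i : ℕ, N ≤ i + 1 →
      IsPullback (f.app (op (Globe.mk (i + 1)))) (X.boundary i) (Y.boundary i)
        (mapParallelPair f i) := by
  simp only [isPullback_boundary_iff]
  constructor
  · intro hf i hi y p hp h
    obtain ⟨x, ⟨hx, rfl⟩, hx'⟩ := hf (i + 1) y (CoskCell.ofParallel hi p hp) (by
      refine CoskCell.ext_bd hi fun ε => ?_
      rw [← CoskCell.map_bd, CoskCell.bd_ofParallel, CoskCell.map_ofCell, CoskCell.bd_ofCell, h])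
    refine ⟨x, ⟨rfl, fun δ => ?_⟩, fun x' ⟨h₁, h₂⟩ => hx' _ ⟨?_, h₁⟩⟩
    -- The boundary of `x` and `p δ` agree in the coskeleton and in `Y`, hence in `X`.
    · refine (hf i _ _ (CoskCell.map_ofCell f (p δ))).unique ⟨?_, ?_⟩ ⟨rfl, rfl⟩
      · rw [← CoskCell.bd_ofCell, hx, CoskCell.bd_ofParallel]
      · rw [mapCell_bd, h]
    · refine CoskCell.ext_bd hi fun ε => ?_
      rw [CoskCell.bd_ofParallel, CoskCell.bd_ofCell, h₂]
  · intro hf i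
    induction i using Nat.strong_induction_on with
    | h i ih =>
    intro y c h
    rcases lt_or_ge i N with hi | hi
    · obtain ⟨x, rfl⟩ : ∃ x, c = CoskCell.ofCell x := ⟨_, c.eq_ofCell hi false⟩
      rw [CoskCell.map_ofCell] at h
      exact ⟨x, ⟨rfl, CoskCell.ofCell_injective hi h⟩,
        fun x' hx' => CoskCell.ofCell_injective hi hx'.1⟩
    · obtain ⟨j, rfl⟩ : ∃ j, i = j + 1 := ⟨i - 1, by omega⟩
      have hc : ∀ ε, (c.bd ε j.lt_succ_self).map f =
          CoskCell.ofCell (Y.bd ε j.lt_succ_self y) := fun ε => by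
        rw [CoskCell.map_bd, h, CoskCell.bd_ofCell]
      choose p hp hp' using fun ε => ih j j.lt_succ_self _ _ (hc ε)
      -- The `l`-faces of both lifts solve the same lifting problem in dimension `l`, whose solution
      -- is unique.
      have hpar : X.Parallel j (p false) (p true) := by
        rw [parallel_iff]
        intro ε l hl
        refine (ih l (hl.trans j.lt_succ_self) (Y.bd ε (hl.trans j.lt_succ_self) y)
          (c.bd ε (hl.trans j.lt_succ_self)) ?_).unique ⟨?_, ?_⟩ ⟨?_, ?_⟩
        · rw [CoskCell.map_bd, h, CoskCell.bd_ofCell]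
        · rw [← CoskCell.bd_ofCell, (hp _).1, CoskCell.bd_bd]
        · rw [mapCell_bd, (hp _).2, bd_bd]
        · rw [← CoskCell.bd_ofCell, (hp _).1, CoskCell.bd_bd]
        · rw [mapCell_bd, (hp _).2, bd_bd]
      obtain ⟨x, ⟨hx, hx'⟩, hu⟩ := hf j hi y p hpar fun δ => (hp δ).2
      refine ⟨x, ⟨CoskCell.ext_bd hi fun ε => ?_, hx⟩, fun x' ⟨h₁, h₂⟩ => hu _ ⟨h₂, fun δ => ?_⟩⟩
      · rw [CoskCell.bd_ofCell, hx', (hp ε).1]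
      · refine hp' δ _ ⟨?_, ?_⟩
        · rw [← CoskCell.bd_ofCell, h₁]
        · rw [mapCell_bd, h₂]

/-- With no components at all, the coskeleton is terminal. -/
theorem coskCartesian_zero_iff (f : X ⟶ Y) : CoskCartesian 0 f ↔ IsIso f := by
  refine ⟨fun h => ?_, fun _ => .of_isIso f⟩
  rw [NatTrans.isIso_iff_isIso_app]
  rintro ⟨⟨i⟩⟩
  rw [isIso_iff_bijective]
  have e : ∀ {W : GlobSet.{u}} (c c' : W.CoskCell 0 i), c = c' := fun c c' => by
    ext m hm
    exact absurd hm m.not_lt_zero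
  constructor
  · intro x x' hx
    exact (h i (mapCell f i x') (CoskCell.ofCell x) (e _ _)).unique ⟨rfl, hx⟩ ⟨e _ _, rfl⟩
  · intro y
    let c : X.CoskCell 0 i :=
      ⟨fun m hm => absurd hm m.not_lt_zero, fun _ _ _ m _ hm => absurd hm m.not_lt_zero,
        fun hm => absurd hm i.not_lt_zero⟩
    obtain ⟨x, hx, -⟩ := h i y c (e _ _)
    exact ⟨x, hx.2⟩

theorem nFullyFaithful_iff {n : ℤ} (hn : -1 ≤ n) (f : X ⟶ Y) :
    nFullyFaithful n f ↔ CoskCartesian (n + 1).toNat f := by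
  rcases hn.eq_or_lt with rfl | hn
  · refine Iff.trans ?_ (coskCartesian_zero_iff f).symm
    exact ⟨fun h => h.1 rfl, fun h => ⟨fun _ => h, fun h => absurd h (by decide)⟩⟩
  · rw [coskCartesian_iff_isPullback (by omega)]
    constructor
    · exact fun h i hi => h.2 (by omega) i (by omega)
    · exact fun h => ⟨fun h => absurd h (by omega), fun _ i hi => h i (by omega)⟩

instance {n : ℤ} : (nBijective.{u} n).RespectsIso := by
  refine MorphismProperty.RespectsIso.mk _ (fun e f hf i hi => ?_) (fun e f hf i hi => ?_) <;>
  · have := hf i hi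
    rw [NatTrans.comp_app]
    infer_instance

theorem nFullyFaithful_respectsIso {n : ℤ} (hn : -1 ≤ n) :
    (nFullyFaithful.{u} n).RespectsIso := by
  refine MorphismProperty.RespectsIso.mk _ (fun e f hf => ?_) (fun e f hf => ?_) <;>
  rw [nFullyFaithful_iff hn] at hf ⊢
  · exact (CoskCartesian.of_isIso _).comp hf
  · exact hf.comp (.of_isIso _)

/-! ### The factorisation through the coskeleton -/

/-- The unit of the coskeleton. -/
def coskUnit (X : GlobSet.{u}) (N : ℕ) : X ⟶ X.cosk N :=
  homMk (fun _ x => CoskCell.ofCell x) fun ε _ _ h x => (CoskCell.bd_ofCell ε h x).symm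

/-- The action of the coskeleton on maps. -/
def coskMap (N : ℕ) (f : X ⟶ Y) : X.cosk N ⟶ Y.cosk N :=
  homMk (fun _ c => CoskCell.map f c) fun ε _ _ h c => CoskCell.map_bd f ε h c

/-- The pullback of the action of the coskeleton on `f` along the unit of the coskeleton. -/
def coskImage (N : ℕ) (f : X ⟶ Y) : GlobSet.{u} where
  obj a := {p : Y.obj a × (X.cosk N).obj a // (coskMap N f).app a p.2 = (coskUnit Y N).app a p.1}
  map {a b} g := TypeCat.ofHom fun p => ⟨(Y.map g p.1.1, (X.cosk N).map g p.1.2), by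
    have h₁ := ConcreteCategory.congr_hom ((coskMap N f).naturality g) p.1.2
    have h₂ := ConcreteCategory.congr_hom ((coskUnit Y N).naturality g) p.1.1
    exact h₁.trans ((congrArg ((Y.cosk N).map g) p.2).trans h₂.symm)⟩
  map_id a := by
    ext p
    · exact ConcreteCategory.congr_hom (Y.map_id a) _
    · exact ConcreteCategory.congr_hom ((X.cosk N).map_id a) _
  map_comp g h := by
    ext p
    · exact ConcreteCategory.congr_hom (Y.map_comp g h) _
    · exact ConcreteCategory.congr_hom ((X.cosk N).map_comp g h) _

namespace coskImage

variable (N) (f : X ⟶ Y)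

/-- The first factor of the factorisation of `f` through `coskImage N f`. -/
def ι : X ⟶ coskImage N f :=
  homMk (fun _ x => ⟨(mapCell f _ x, CoskCell.ofCell x), CoskCell.map_ofCell f x⟩)
    fun ε _ _ h x => Subtype.ext (Prod.ext (mapCell_bd f ε h x) (CoskCell.bd_ofCell ε h x).symm)

/-- The second factor of the factorisation of `f` through `coskImage N f`. -/
def π : coskImage N f ⟶ Y :=
  homMk (fun _ p => p.1.1) fun _ _ _ _ _ => rfl

theorem ι_π : ι N f ≫ π N f = f := rfl

/-- Below `N` the units of `X` and `Y` are bijective. The projection to `X.cosk N`, a pullback of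
the unit of `Y`, is then bijective too, and composing it with `ι` gives the unit of `X`. -/
theorem bijective_ι {i : ℕ} (hi : i < N) : Function.Bijective (mapCell (ι N f) i) := by
  constructor
  · intro x x' h
    exact CoskCell.ofCell_injective hi (Prod.ext_iff.1 (Subtype.ext_iff.1 h)).2
  · rintro ⟨⟨y, c⟩, h⟩
    change X.CoskCell N i at c
    obtain ⟨x, rfl⟩ : ∃ x, c = CoskCell.ofCell x := ⟨_, c.eq_ofCell hi false⟩
    refine ⟨x, Subtype.ext (Prod.ext ?_ rfl)⟩
    exact CoskCell.ofCell_injective hi ((CoskCell.map_ofCell f x).symm.trans h)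

theorem bdLE_cosk (δ : Bool) {m i : ℕ} (hN : m < N) (hm : m ≤ i) (c : X.CoskCell N i) :
    (X.cosk N).bdLE δ hm c = (CoskCell.ofCell (c.val m hN hm δ) : X.CoskCell N m) := by
  rcases hm.lt_or_eq with h | rfl
  · refine (bdLE_of_lt _ δ h _).trans ((CoskCell.eq_ofCell hN (CoskCell.bd δ h c) false).trans ?_)
    rw [CoskCell.bd_val, if_pos rfl]
  · exact (bdLE_self _ δ _).trans (CoskCell.eq_ofCell hN c δ)

/-- When the coskeleta of `X` and `coskImage N f` are identified along `ι`, the unit of the latter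
becomes the second projection. -/
theorem ofCell_eq_map_ι {i : ℕ} (z : (coskImage N f).Cell i) :
    (CoskCell.ofCell z : (coskImage N f).CoskCell N i) =
      CoskCell.map (ι N f) (i := i) z.1.2 := by
  ext m hN hm δ
  refine Subtype.ext (Prod.ext ?_ ?_)
  · exact congrArg (fun c : Y.CoskCell N i => c.val m hN hm δ) z.2.symm
  · exact bdLE_cosk N δ hN hm z.1.2

/-- Under that identification, the unit square at `π` is the pullback defining `coskImage N f`. -/
theorem coskCartesian_π : CoskCartesian N (π N f) := by
  intro i y c h
  have hι : ∀ i < N, Function.Bijective (mapCell (ι N f) i) := fun _ => bijective_ι N f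
  refine ⟨⟨(y, c.mapInv _ hι), ?_⟩, ⟨?_, rfl⟩, ?_⟩
  · change CoskCell.map (π N f) (CoskCell.map (ι N f) (c.mapInv _ hι)) = CoskCell.ofCell y
    rw [CoskCell.map_mapInv, h]
  · exact (ofCell_eq_map_ι N f _).trans (CoskCell.map_mapInv ..)
  · rintro z ⟨hz, rfl⟩
    refine Subtype.ext (Prod.ext rfl ?_)
    refine (CoskCell.mapInv_map _ hι _).symm.trans (congrArg (CoskCell.mapInv _ hι) ?_)
    exact (ofCell_eq_map_ι N f z).symm.trans hz

end coskImage

theorem exists_nBijective_nFullyFaithful {n : ℤ} (hn : -1 ≤ n) (f : X ⟶ Y) :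
    ∃ (Z : GlobSet.{u}) (g : X ⟶ Z) (h : Z ⟶ Y), nBijective n g ∧ nFullyFaithful n h ∧ g ≫ h = f :=
  ⟨_, coskImage.ι (n + 1).toNat f, coskImage.π _ f,
    (nBijective_iff ..).2 fun _ => coskImage.bijective_ι _ f,
    (nFullyFaithful_iff hn _).2 (coskImage.coskCartesian_π _ f), coskImage.ι_π _ f⟩

/-- The image in `X.cosk N` of a filler at `b` must be that of `b` under the inverse of `l` on
coskeleta followed by `u`. Together with `mapCell v i b` this determines a unique cell of `X`;
uniqueness also gives compatibility with faces. -/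
theorem isOrthogonalTo_of_coskCartesian {A B : GlobSet.{u}} {l : A ⟶ B} {p : X ⟶ Y}
    (hl : ∀ i < N, Function.Bijective (mapCell l i)) (hp : CoskCartesian N p) :
    IsOrthogonalTo l p := by
  intro u v w
  have key : ∀ {i : ℕ} (b : B.Cell i), CoskCell.map p (CoskCell.map u
      ((CoskCell.ofCell b).mapInv l hl)) = CoskCell.ofCell (mapCell v i b) := fun b => by
    change CoskCell.map (u ≫ p) _ = _
    rw [w]
    change CoskCell.map v (CoskCell.map l _) = _
    rw [CoskCell.map_mapInv, CoskCell.map_ofCell]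
  choose d hd hd' using fun i b => hp i _ _ (key (i := i) b)
  refine ⟨homMk d fun ε m i h b => ?_, ⟨?_, ?_⟩, ?_⟩
  · refine (hd' m _ _ ⟨?_, ?_⟩).symm
    · rw [← CoskCell.bd_ofCell, (hd i b).1, ← CoskCell.map_bd, CoskCell.bd_mapInv,
        CoskCell.bd_ofCell]
    · rw [mapCell_bd, (hd i b).2, mapCell_bd]
  · ext ⟨⟨i⟩⟩ a
    refine (hd' i (mapCell l i a) _ ⟨?_, ?_⟩).symm
    · rw [← CoskCell.map_ofCell l, CoskCell.mapInv_map]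
      exact (CoskCell.map_ofCell u a).symm
    · exact congrArg (fun g => mapCell g i a) w
  · ext ⟨⟨i⟩⟩ b
    exact (hd i b).2
  · rintro d' ⟨rfl, rfl⟩
    ext ⟨⟨i⟩⟩ b
    refine hd' i b _ ⟨?_, rfl⟩
    change _ = CoskCell.map d' (CoskCell.map l _)
    rw [CoskCell.map_mapInv]
    exact (CoskCell.map_ofCell d' b).symm

theorem isOrthogonalTo_of_nBijective {n : ℤ} (hn : -1 ≤ n) {A B : GlobSet.{u}} {l : A ⟶ B}
    {p : X ⟶ Y} (hl : nBijective n l) (hp : nFullyFaithful n p) : IsOrthogonalTo l p :=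
  isOrthogonalTo_of_coskCartesian ((nBijective_iff n l).1 hl) ((nFullyFaithful_iff hn p).1 hp)

end GlobSet

/-! ### Lifting orthogonal factorisation systems to algebras for a monad -/

section

variable {C : Type*} [Category* C]

theorem IsOrthogonalTo.hom_ext {A B X Y : C} {i : A ⟶ B} {p : X ⟶ Y} (h : IsOrthogonalTo i p)
    {d d' : B ⟶ X} (h₁ : i ≫ d = i ≫ d') (h₂ : d ≫ p = d' ≫ p) : d = d' :=
  (h (i ≫ d') (d' ≫ p) (Category.assoc ..)).unique ⟨h₁, h₂⟩ ⟨rfl, rfl⟩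

/-- The usual retract argument: if `l ≫ r` is orthogonal to `r`, the filler is a section of `r`, and
orthogonality of `l` to `r` makes it an inverse; dually for `l`. -/
theorem IsOrthogonalFactorisationSystem.of_isOrthogonalTo {L R : MorphismProperty C}
    [L.RespectsIso] [R.RespectsIso]
    (fac : ∀ {X Y : C} (f : X ⟶ Y), ∃ (Z : C) (g : X ⟶ Z) (h : Z ⟶ Y), L g ∧ R h ∧ g ≫ h = f)
    (orth : ∀ {A B X Y : C} (i : A ⟶ B) (p : X ⟶ Y), L i → R p → IsOrthogonalTo i p) :
    IsOrthogonalFactorisationSystem L R where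
  factorisation := fac
  left_iff i := by
    refine ⟨fun hi _ _ p hp => orth i p hi hp, fun h => ?_⟩
    obtain ⟨Z, l, r, hl, hr, rfl⟩ := fac i
    obtain ⟨d, ⟨hd, hd'⟩, -⟩ := h r hr l (𝟙 _) (Category.comp_id _).symm
    have : IsIso r := ⟨d, (orth l r hl hr).hom_ext (by simpa using hd) (by simp [hd']), hd'⟩
    exact MorphismProperty.RespectsIso.postcomp L r l hl
  right_iff p := by
    refine ⟨fun hp _ _ i hi => orth i p hi hp, fun h => ?_⟩
    obtain ⟨Z, l, r, hl, hr, rfl⟩ := fac p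
    obtain ⟨d, ⟨hd, hd'⟩, -⟩ := h l hl (𝟙 _) r (Category.id_comp _)
    have : IsIso l :=
      ⟨d, hd, (orth l r hl hr).hom_ext (by simp [reassoc_of% hd]) (by simpa using hd')⟩
    exact MorphismProperty.RespectsIso.precomp R l r hr

variable {P : Monad C}

/-- An orthogonal lift of algebra morphisms is an algebra morphism. -/
theorem IsOrthogonalTo.of_forget {A B X Y : P.Algebra} {i : A ⟶ B} {p : X ⟶ Y}
    (h : IsOrthogonalTo i.f p.f) (h' : IsOrthogonalTo (P.map i.f) p.f) :
    IsOrthogonalTo i p := by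
  intro f g w
  obtain ⟨d, ⟨hd, hd'⟩, hu⟩ := h f.f g.f (congrArg Monad.Algebra.Hom.f w)
  -- Both composites fill the same square from `P.map i.f` to `p.f`.
  have hh : P.map d ≫ X.a = B.a ≫ d := by
    refine h'.hom_ext ?_ ?_
    · rw [← Category.assoc, ← Functor.map_comp, hd, f.h, ← Category.assoc, i.h, Category.assoc, hd]
    · rw [Category.assoc, ← p.h, ← Category.assoc, ← Functor.map_comp, hd', g.h, Category.assoc, hd']
  refine ⟨⟨d, hh⟩, ⟨Monad.Algebra.Hom.ext hd, Monad.Algebra.Hom.ext hd'⟩, ?_⟩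
  rintro d' ⟨rfl, rfl⟩
  exact Monad.Algebra.Hom.ext (hu _ ⟨rfl, rfl⟩)

/-- The middle object of a factorisation of an algebra morphism carries an algebra structure such
that both factors are algebra morphisms. -/
theorem Monad.Algebra.exists_structure_of_factorisation {A B : P.Algebra} (f : A ⟶ B) {Z : C}
    {l : A.A ⟶ Z} {r : Z ⟶ B.A} (w : l ≫ r = f.f) (h₀ : IsOrthogonalTo l r)
    (h₁ : IsOrthogonalTo (P.map l) r) (h₂ : IsOrthogonalTo (P.map (P.map l)) r) :
    ∃ z : P.obj Z ⟶ Z, P.η.app Z ≫ z = 𝟙 Z ∧ P.μ.app Z ≫ z = P.map z ≫ z ∧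
      P.map l ≫ z = A.a ≫ l ∧ P.map r ≫ B.a = z ≫ r := by
  -- The two factors are algebra morphisms precisely when `z` fills this square.
  obtain ⟨z, ⟨hz, hz'⟩, -⟩ := h₁ (A.a ≫ l) (P.map r ≫ B.a) (by
    rw [Category.assoc, w, ← f.h, ← w, Functor.map_comp, Category.assoc])
  -- The unit law equates maps out of `Z`, the associativity law maps out of `P (P Z)`. Each is
  -- checked after precomposing with `l` or `P (P l)` and after postcomposing with `r`, where it
  -- reduces to the laws of `A` and `B`.
  refine ⟨z, h₀.hom_ext ?_ ?_, h₂.hom_ext ?_ ?_, hz, hz'.symm⟩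
  · have : l ≫ P.η.app Z ≫ z = P.η.app A.A ≫ P.map l ≫ z := P.η.naturality_assoc l z
    rw [this, hz, A.unit_assoc, Category.comp_id]
  · have : r ≫ P.η.app B.A ≫ B.a = P.η.app Z ≫ P.map r ≫ B.a := P.η.naturality_assoc r B.a
    rw [Category.assoc, hz', ← this, B.unit, Category.comp_id, Category.id_comp]
  · have : P.map (P.map l) ≫ P.μ.app Z ≫ z = P.μ.app A.A ≫ P.map l ≫ z :=
      P.μ.naturality_assoc l z
    rw [this, hz, A.assoc_assoc, ← Functor.map_comp_assoc, hz, Functor.map_comp_assoc, hz]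
  · have : P.map (P.map r) ≫ P.μ.app B.A ≫ B.a = P.μ.app Z ≫ P.map r ≫ B.a :=
      P.μ.naturality_assoc r B.a
    rw [Category.assoc, Category.assoc, hz', ← this, B.assoc, ← Functor.map_comp_assoc, ← hz',
      Functor.map_comp_assoc, hz']

end

theorem mainTheorem11 (P : Monad GlobSet.{u}) (hP : IsGlobularOperad P) (n : ℤ) (hn : -1 ≤ n) :
    IsOrthogonalFactorisationSystem
      ((GlobSet.nBijective.{u} n).inverseImage P.forget)
      ((GlobSet.nFullyFaithful.{u} n).inverseImage P.forget) := by
  have := GlobSet.nFullyFaithful_respectsIso.{u} hn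
  have hmap {X Y : GlobSet.{u}} (f : X ⟶ Y) (hf : GlobSet.nBijective n f) :
      GlobSet.nBijective n (P.map f) := GlobSet.nBijective_map_of_isGlobularOperad hP n f hf
  have horth {A B X Y : GlobSet.{u}} (i : A ⟶ B) (p : X ⟶ Y) (hi : GlobSet.nBijective n i)
      (hp : GlobSet.nFullyFaithful n p) : IsOrthogonalTo i p :=
    GlobSet.isOrthogonalTo_of_nBijective hn hi hp
  refine .of_isOrthogonalTo (fun {A B} f => ?_) fun i p hi hp =>
    .of_forget (horth _ _ hi hp) (horth _ _ (hmap _ hi) hp)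
  obtain ⟨Z, l, r, hl, hr, w⟩ := GlobSet.exists_nBijective_nFullyFaithful hn f.f
  obtain ⟨z, h₁, h₂, h₃, h₄⟩ := Monad.Algebra.exists_structure_of_factorisation f w
    (horth _ _ hl hr) (horth _ _ (hmap _ hl) hr) (horth _ _ (hmap _ (hmap _ hl)) hr)
  exact ⟨⟨Z, z, h₁, h₂⟩, ⟨l, h₃⟩, ⟨r, h₄⟩, hl, hr, Monad.Algebra.Hom.ext w⟩
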